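/- **Setting.** Let $d\ge 1$ and let $X$ be a finite set of closed nondegenerate $d$-rectangles in $\mathbb R^d$ with sides parallel to the axes (prototiles), no two of which are translates of each other. Let $T$ be a perfect tiling of $\mathbb R^d$ by translates of elements of $X$: it is aperiodic, has finitely many patches of diameter $<s$ up to translation for every $s>0$, and is repetitive (for every patch there is $s>0$ such that every ball of radius $s$ contains a translate of this patch belonging to $T$). Let $\Omega_T$ be its continuous hull, the closure of $\{T+v : v\in\mathbb R^d\}$ for the tiling distance, with the $\mathbb R^d$-action by translation. For $S\in\Omega_T$, the leaf of $S$ is parametrized by $x\mapsto S-x$. A chart of the lamination $\Omega_T$ is given by a nonempty bounded open set $V\subset\mathbb R^d$ and a set $C\subset\Omega_T$ such that $V\times C\to\Omega_T$, $(x,c)\mapsto c-x$, is a homeomorphism onto an open set. **Measures and current.** Let $\mu$ be a finite translation-invariant Borel measure on $\Omega_T$. It induces on the transversal $C$ of a chart the transverse measure $\mu^t(B)=\mu(\{c-x : x\in V, c\in B\})/\lambda_d(V)$. The Ruelle–Sullivan current $\mathcal C_{\mu^t}$ sends a leafwise $d$-form $\omega=g\,dx_1\wedge\dots\wedge dx_d$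 to $\sum_i\int_{C_i}\big(\int_{V_i}(\rho_i g)(c-x)\,dx\big)\,d\mu^t(c)$, for any finite atlas $(V_i,C_i)$ and any subordinate partition of unity $(\rho_i)$. Choose a point $y_p$ in the interior of each $p\in X$; the canonical transversal $\Omega_{T,Y}$ is the set of $S\in\Omega_T$ having a tile $p-y_p$ for some $p\in X$. It carries the transverse measure $\mu^t$ obtained from the chart $V\times\Omega_{T,Y}$, with $V$ any small enough ball around $0$. **The sequence $\mathcal F$.** A block is a connected finite union of closed nondegenerate rectangles with sides parallel to the axes. A box is given by a block $P$ and a nonempty compact set $C\subset\Omega_T$ such that $\operatorname{int}P\times C\to\Omega_T$, $(x,c)\mapsto c-x$, is a homeomorphism onto an open set (the box); its verticals are the images of the sets $\{x\}\times C$, its vertical boundary is the image of $\partial P\times C$, and its closure is the image of $P\times C$. A box decomposition is a finite family of pairwise disjoint boxes whose closures cover $\Omega_T$; it cuts every leaf into tiles (translates of the blocks $P$), each of which has a type (its box). Let $\mathcal B^{(0)},\mathcal B^{(1)},\dots$ be box decompositions, where $\mathcal B^{(0)}$ consists of the boxes $(p,\{S\in\Omega_T : p\in S\})$, $p\in X$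 (those with nonempty second entry), and such that for every $n$ the decomposition $\mathcal B^{(n+1)}$ * is zoomed out of $\mathcal B^{(n)}$: for a point lying in a box of $\mathcal B^{(n+1)}$ and in a box of $\mathcal B^{(n)}$, its vertical in the former is contained in its vertical in the latter; vertical boundaries of boxes of $\mathcal B^{(n+1)}$ are contained in the union of the vertical boundaries of boxes of $\mathcal B^{(n)}$; every tile of $\mathcal B^{(n+1)}$ contains a tile of $\mathcal B^{(n)}$ in its interior; * forces its border: the types and relative positions of the tiles of $\mathcal B^{(n)}$ that meet a tile of $\mathcal B^{(n+1)}$ depend only on the type of the latter. Let $B_n$ be the quotient of $\Omega_T$ by the equivalence relation generated by lying on the same vertical of the closure of a box of $\mathcal B^{(n)}$ (the branched oriented flat manifold obtained by gluing the tile types of $\mathcal B^{(n)}$ along their boundaries), let $\pi_n:\Omega_T\to B_n$ be the projection, let $f_n:B_{n+1}\to B_n$ be the map with $f_n\circ\pi_{n+1}=\pi_n$, and let $\mathcal F=(f_n)_n$ and $\Omega(\mathcal F)=\varprojlim B_n$. Smooth forms on $B_n$ are the fields of covectors that are smooth along all leaf maps $x\mapsto\pi_n(S-x)$; they define $H^*_{DR}(B_n)$.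 The $d$-regions of $B_n$ are the prototiles contained in the tile types of $\mathcal B^{(n)}$; an integral $d$-chain of $d$-regions is a cycle if along every $(d-1)$-cell its coefficients have the same sum on the two sides. A class in $H^d_{DR}(B_n)$ is integral if it has integer values on all integral $d$-cycles; these classes form $H^{d,int}_{DR}(B_n)$. Put $H^d_{DR}(\Omega(\mathcal F))=\varinjlim H^d_{DR}(B_n)$ and $H^{d,int}_{DR}(\Omega(\mathcal F))=\varinjlim H^{d,int}_{DR}(B_n)$. **Proposition.** The Ruelle–Sullivan current defines a linear form on $H^d_{DR}(\Omega(\mathcal F))$, also denoted by $\mathcal C_{\mu^t}$, whose value on the class of a $d$-form $\omega$ on $B_n$ is $\mathcal C_{\mu^t}(\pi_n^*\omega)$, and $$\mathcal C_{\mu^t}\big(H^{d,int}_{DR}(\Omega(\mathcal F))\big)=\Big\{\int_{\Omega_{T,Y}} f\,d\mu^t \;:\; f:\Omega_{T,Y}\to\mathbb Z\ \text{continuous}\Big\}.$$ -/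

import Mathlib

open MeasureTheory Set Topology
open scoped Pointwise

noncomputable section

namespace TilingHull

/-- Euclidean space of dimension `d`. -/
abbrev E (d : ℕ) := EuclideanSpace ℝ (Fin d)

variable {d : ℕ}

/-! ### Rectangles and blocks -/

/-- The closed rectangle with sides parallel to the axes and extreme corners `a` and `b`. -/
def rect (a b : E d) : Set (E d) := {x | ∀ i, a i ≤ x i ∧ x i ≤ b i}

/-- A well oriented `d`-rectangle (nondegenerate and closed). -/
def IsRect (p : Set (E d)) : Prop := ∃ a b : E d, (∀ i, a i < b i) ∧ p = rect a b

/-- A block: a connected finite union of well oriented `d`-rectangles. -/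
def IsBlock (P : Set (E d)) : Prop :=
  IsConnected P ∧ ∃ R : Set (Set (E d)), R.Finite ∧ (∀ p ∈ R, IsRect p) ∧ P = ⋃₀ R

/-! ### Tilings -/

/-- The tiling space `T(X)`: tilings of `ℝ^d` whose tiles are translates of elements of `X`. -/
@[ext]
structure Tiling (X : Set (Set (E d))) where
  tiles : Set (Set (E d))
  countable : tiles.Countable
  type_mem : ∀ t ∈ tiles, ∃ p ∈ X, ∃ u : E d, t = u +ᵥ p
  cover : ⋃₀ tiles = univ
  disjoint : ∀ t ∈ tiles, ∀ s ∈ tiles, t ≠ s → Disjoint (interior t) (interior s)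

variable {X : Set (Set (E d))}

namespace Tiling

/-- The translate `T + v`. -/
def translate (v : E d) (T : Tiling X) : Tiling X where
  tiles := (fun t => v +ᵥ t) '' T.tiles
  countable := T.countable.image _
  type_mem := by
    rintro _ ⟨t, ht, rfl⟩
    obtain ⟨p, hp, u, rfl⟩ := T.type_mem t ht
    exact ⟨p, hp, v + u, by simp [vadd_vadd]⟩
  cover := by
    rw [eq_univ_iff_forall]
    intro x
    have hx : -v +ᵥ x ∈ ⋃₀ T.tiles := by rw [T.cover]; trivial
    obtain ⟨t, ht, hxt⟩ := hx
    exact ⟨v +ᵥ t, ⟨t, ht, rfl⟩, by rwa [mem_vadd_set_iff_neg_vadd_mem]⟩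
  disjoint := by
    rintro _ ⟨t, ht, rfl⟩ _ ⟨s, hs, rfl⟩ hts
    have hne : t ≠ s := fun h => hts (by rw [h])
    have h := T.disjoint t ht s hs hne
    simp only [interior_vadd]
    exact (disjoint_image_iff (AddAction.injective v)).mpr h

instance : AddAction (E d) (Tiling X) where
  vadd := translate
  zero_vadd T := by
    apply Tiling.ext
    change (fun t => (0 : E d) +ᵥ t) '' T.tiles = T.tiles
    simp
  add_vadd u v T := by
    apply Tiling.ext
    change (fun t => (u + v) +ᵥ t) '' T.tiles
      = (fun t => u +ᵥ t) '' ((fun t => v +ᵥ t) '' T.tiles)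
    rw [image_image]
    simp only [vadd_vadd]

theorem tiles_vadd (v : E d) (T : Tiling X) :
    (v +ᵥ T).tiles = (fun t => v +ᵥ t) '' T.tiles := rfl

/-- The restriction `T ∩ K`: the traces on `K` of the tiles of `T`. -/
def trace (T : Tiling X) (K : Set (E d)) : Set (Set (E d)) := (fun t => t ∩ K) '' T.tiles

/-- The set `A` of all `ε ∈ ]0,1[` such that `T + x` and `S + y` coincide on the closed ball of
radius `1/ε` for some vectors `x`, `y` of norm at most `ε`. -/
def closeness (T S : Tiling X) : Set ℝ :=
  {ε | 0 < ε ∧ ε < 1 ∧ ∃ x ∈ Metric.closedBall (0 : E d) ε, ∃ y ∈ Metric.closedBall (0 : E d) ε,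
    (x +ᵥ T).trace (Metric.closedBall 0 (1 / ε)) = (y +ᵥ S).trace (Metric.closedBall 0 (1 / ε))}

open scoped Classical in
/-- The tiling distance `δ`. -/
def dist (T S : Tiling X) : ℝ := if (closeness T S).Nonempty then sInf (closeness T S) else 1

/-- The topology of `T(X)` induced by `δ`. -/
instance : TopologicalSpace (Tiling X) where
  IsOpen U := ∀ T ∈ U, ∃ ε > 0, ∀ S, dist T S < ε → S ∈ U
  isOpen_univ := fun _ _ => ⟨1, one_pos, fun _ _ => trivial⟩
  isOpen_inter := by
    rintro U V hU hV T ⟨h1, h2⟩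
    obtain ⟨a, ha, hA⟩ := hU T h1
    obtain ⟨b, hb, hB⟩ := hV T h2
    exact ⟨min a b, lt_min ha hb, fun S hS =>
      ⟨hA S (hS.trans_le (min_le_left _ _)), hB S (hS.trans_le (min_le_right _ _))⟩⟩
  isOpen_sUnion := by
    rintro 𝒰 h𝒰 T ⟨U, hU, hT⟩
    obtain ⟨a, ha, hA⟩ := h𝒰 U hU T hT
    exact ⟨a, ha, fun S hS => ⟨U, hU, hA S hS⟩⟩

theorem trace_inter (T : Tiling X) {K L : Set (E d)} (h : K ⊆ L) :
    T.trace K = (fun t => t ∩ K) '' T.trace L := by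
  simp only [trace, image_image, inter_assoc, inter_eq_self_of_subset_right h]

theorem trace_vadd (v : E d) (T : Tiling X) (K : Set (E d)) :
    (v +ᵥ T).trace (v +ᵥ K) = (fun t => v +ᵥ t) '' T.trace K := by
  simp only [trace, tiles_vadd, image_image, vadd_set_inter]

theorem continuous_vadd (v : E d) : Continuous (fun T : Tiling X => v +ᵥ T) := by
  rw [continuous_def]
  intro U hU T hT
  obtain ⟨ε, hε, h⟩ := hU _ hT
  set η : ℝ := min ε 1 / 2 with hη
  have hm : 0 < min ε 1 := lt_min hε one_pos
  have hη0 : 0 < η := by positivity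
  have hη1 : η < 1 := by have := min_le_right ε 1; linarith
  have hηε : η < ε := by have := min_le_left ε 1; linarith
  have hden : 0 < 1 / η + ‖v‖ := by positivity
  refine ⟨min (min η 1) (1 / (1 / η + ‖v‖)), by positivity, fun S hS => h _ ?_⟩
  have hne : (closeness T S).Nonempty := by
    by_contra hne
    rw [dist, if_neg hne] at hS
    have := hS.trans_le ((min_le_left _ _).trans (min_le_right _ _))
    exact lt_irrefl _ this
  rw [dist, if_pos hne] at hS
  obtain ⟨r, ⟨hr0, hr1, x, hx, y, hy, hxy⟩, hr⟩ := exists_lt_of_csInf_lt hne hS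
  have hrη : r < η := hr.trans_le ((min_le_left _ _).trans (min_le_left _ _))
  have hrv : 1 / η + ‖v‖ < 1 / r := by
    rw [lt_one_div hden hr0]
    exact hr.trans_le (min_le_right _ _)
  have hmem : η ∈ closeness (v +ᵥ T) (v +ᵥ S) := by
    refine ⟨hη0, hη1, x, Metric.closedBall_subset_closedBall hrη.le hx, y,
      Metric.closedBall_subset_closedBall hrη.le hy, ?_⟩
    have hsub : Metric.closedBall (0 : E d) (1 / η) ⊆ v +ᵥ Metric.closedBall (0 : E d) (1 / r) := by
      intro z hz
      rw [mem_vadd_set_iff_neg_vadd_mem, mem_closedBall_zero_iff]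
      rw [mem_closedBall_zero_iff] at hz
      calc ‖-v +ᵥ z‖ = ‖-v + z‖ := rfl
        _ ≤ ‖-v‖ + ‖z‖ := norm_add_le _ _
        _ ≤ 1 / r := by rw [norm_neg]; linarith
    have hcomm : ∀ (z : E d) (R : Tiling X), z +ᵥ (v +ᵥ R) = v +ᵥ (z +ᵥ R) := fun z R => by
      rw [vadd_vadd, vadd_vadd, add_comm]
    rw [hcomm, hcomm, trace_inter _ hsub, trace_inter _ hsub, trace_vadd, trace_vadd, hxy]
  rw [dist, if_pos ⟨η, hmem⟩]
  exact (csInf_le ⟨0, fun z hz => hz.1.le⟩ hmem).trans_lt hηε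

/-- The orbit of `T` under translations. -/
def orbit (T : Tiling X) : Set (Tiling X) := range fun v : E d => v +ᵥ T

/-- Finite pattern condition: up to translation there are finitely many patches of diameter
smaller than `s`. -/
def FinitePattern (T : Tiling X) : Prop :=
  ∀ s : ℝ, 0 < s → ∃ 𝒬 : Set (Set (Set (E d))), 𝒬.Finite ∧
    ∀ Q ⊆ T.tiles, Q.Finite → Metric.diam (⋃₀ Q) < s →
      ∃ Q' ∈ 𝒬, ∃ u : E d, Q = (fun t => u +ᵥ t) '' Q'

/-- Repetitivity. -/
def Repetitive (T : Tiling X) : Prop :=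
  ∀ Q ⊆ T.tiles, Q.Finite → ∃ s : ℝ, 0 < s ∧ ∀ x : E d, ∃ u : E d,
    ∀ t ∈ Q, u +ᵥ t ∈ T.tiles ∧ u +ᵥ t ⊆ Metric.closedBall x s

/-- Perfect tilings: aperiodic, with finite pattern condition and repetitivity. -/
structure IsPerfect (T : Tiling X) : Prop where
  aperiodic : ∀ x : E d, x ≠ 0 → x +ᵥ T ≠ T
  finitePattern : T.FinitePattern
  repetitive : T.Repetitive

end Tiling

/-! ### The continuous hull -/

/-- The continuous hull `Ω_T`: the closure of the orbit of `T`. -/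
def Hull (T : Tiling X) : Type := {S : Tiling X // S ∈ closure T.orbit}

variable {T : Tiling X}

instance : TopologicalSpace (Hull T) := inferInstanceAs (TopologicalSpace {S // S ∈ closure T.orbit})

instance : MeasurableSpace (Hull T) := borel _

instance : BorelSpace (Hull T) := ⟨rfl⟩

/-- The tiles of a point of the hull. -/
def Hull.tiles (S : Hull T) : Set (Set (E d)) := S.1.tiles

theorem Hull.vadd_mem (v : E d) (S : Hull T) : v +ᵥ S.1 ∈ closure T.orbit := by
  refine map_mem_closure (Tiling.continuous_vadd v) S.2 ?_
  rintro _ ⟨u, rfl⟩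
  exact ⟨v + u, by simp only [add_vadd]⟩

/-- The translation action of `ℝ^d` on the hull. -/
instance : AddAction (E d) (Hull T) where
  vadd v S := ⟨v +ᵥ S.1, S.vadd_mem v⟩
  zero_vadd S := Subtype.ext (zero_vadd _ S.1)
  add_vadd u v S := Subtype.ext (add_vadd u v S.1)

/-- `S` seen from the point `x`, that is `S - x`: what `S` shows at `x`, this tiling shows at `0`.
For fixed `S`, the map `x ↦ seen x S` is the parametrization by `ℝ^d` of the leaf of `S`. -/
def seen (x : E d) (S : Hull T) : Hull T := -x +ᵥ S

/-! ### Transverse measures and the Ruelle–Sullivan current -/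

/-- A chart of the lamination `Ω_T` (written through its inverse
`V × C → Ω_T`, `(x, c) ↦ c - x`). -/
structure Chart (T : Tiling X) where
  V : Set (E d)
  C : Set (Hull T)
  isOpen : IsOpen V
  bounded : Bornology.IsBounded V
  nonempty : V.Nonempty
  emb : IsOpenEmbedding (fun q : V × C => seen (q.1 : E d) (q.2 : Hull T))

/-- The domain `U` of a chart. -/
def Chart.domain (K : Chart T) : Set (Hull T) := {S | ∃ x ∈ K.V, ∃ c ∈ K.C, S = seen x c}

/-- The transverse measure induced by `μ` on the transversal `C` of a chart with plaque `V`: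
the measure `B ↦ μ (V × B) / λ_d (V)`. -/
def transverse (μ : Measure (Hull T)) (V : Set (E d)) (C : Set (Hull T)) : Measure C :=
  (volume V)⁻¹ •
    (μ.comap fun q : V × C => seen (q.1 : E d) (q.2 : Hull T)).map Prod.snd

/-- The canonical transversal `Ω_{T,Y}`: tilings of the hull in which the puncture of some tile
is the origin; `y p` is the puncture of the prototile `p`. -/
def canonicalTransversal (T : Tiling X) (y : X → E d) : Set (Hull T) :=
  {S | ∃ p : X, -(y p) +ᵥ (p : Set (E d)) ∈ S.tiles}

/-- The coefficient of a `d`-covector with respect to `dx_1 ∧ ⋯ ∧ dx_d`. -/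
def coeff (α : E d [⋀^Fin d]→L[ℝ] ℝ) : ℝ := α fun i => EuclideanSpace.single i 1

/-- The Ruelle–Sullivan current of (the transverse measure of) `μ`, evaluated on the leafwise
`d`-form `ω`, by means of a finite atlas `K` and a subordinate partition of unity `ρ`. -/
def ruelleSullivan {ι : Type*} [Fintype ι] (K : ι → Chart T)
    (ρ : PartitionOfUnity ι (Hull T)) (μ : Measure (Hull T))
    (ω : Hull T → E d [⋀^Fin d]→L[ℝ] ℝ) : ℝ :=
  ∑ i, ∫ c : (K i).C, (∫ x in (K i).V, ρ i (seen x c) * coeff (ω (seen x c)))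
    ∂(transverse μ (K i).V (K i).C)

/-! ### Box decompositions -/

/-- A pair `(P, C)` representing the box `int P × C` through `(x, c) ↦ c - x`. -/
structure Box (T : Tiling X) where
  P : Set (E d)
  C : Set (Hull T)

namespace Box

/-- Boxes of block type. -/
structure IsBox (β : Box T) : Prop where
  block : IsBlock β.P
  compact : IsCompact β.C
  nonempty : β.C.Nonempty
  emb : IsOpenEmbedding (fun q : interior β.P × β.C => seen (q.1 : E d) (q.2 : Hull T))

/-- The box itself, an open subset of the hull. -/
def opn (β : Box T) : Set (Hull T) := {S | ∃ x ∈ interior β.P, ∃ c ∈ β.C, S = seen x c}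

/-- The closure of the box. -/
def cls (β : Box T) : Set (Hull T) := {S | ∃ x ∈ β.P, ∃ c ∈ β.C, S = seen x c}

/-- The vertical boundary of the box. -/
def bdry (β : Box T) : Set (Hull T) := {S | ∃ x ∈ frontier β.P, ∃ c ∈ β.C, S = seen x c}

end Box

/-- Box decompositions of block type of the hull. -/
structure IsBoxDecomposition (𝓑 : Set (Box T)) : Prop where
  finite : 𝓑.Finite
  isBox : ∀ β ∈ 𝓑, β.IsBox
  disjoint : ∀ β ∈ 𝓑, ∀ γ ∈ 𝓑, β ≠ γ → Disjoint β.opn γ.opn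
  cover : ⋃ β ∈ 𝓑, β.cls = univ

/-- The box decomposition given by the prototiles: the tilings whose origin is at `x` in a tile of
type `p` are the `c - x` with `c` a tiling having `p` as a tile. -/
def prototileBoxes (T : Tiling X) : Set (Box T) :=
  {β | β.P ∈ X ∧ β.C = {S : Hull T | β.P ∈ S.tiles} ∧ β.C.Nonempty}

/-- `𝓑'` is zoomed out of `𝓑`. -/
structure ZoomedOut (𝓑' 𝓑 : Set (Box T)) : Prop where
  /-- The vertical of a point in a box of `𝓑'` lies in its vertical in a box of `𝓑`. -/
  vertical : ∀ γ ∈ 𝓑', ∀ β ∈ 𝓑, ∀ x ∈ interior γ.P, ∀ w ∈ interior β.P, ∀ c ∈ γ.C, ∀ e ∈ β.C,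
    seen x c = seen w e → ∀ c₁ ∈ γ.C, ∃ e₁ ∈ β.C, seen x c₁ = seen w e₁
  /-- Vertical boundaries of boxes of `𝓑'` lie in vertical boundaries of boxes of `𝓑`. -/
  bdry : ∀ γ ∈ 𝓑', γ.bdry ⊆ ⋃ β ∈ 𝓑, β.bdry
  /-- Every tile of `𝓑'` contains a tile of `𝓑` in its interior. -/
  inner : ∀ γ ∈ 𝓑', ∀ c ∈ γ.C, ∃ β ∈ 𝓑, ∃ u : E d, seen u c ∈ β.C ∧ u +ᵥ β.P ⊆ interior γ.P

/-- `𝓑'` forces its border over `𝓑`: the tiles of `𝓑` that touch a tile of `𝓑'` are determined, up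
to translation, by the box of that tile of `𝓑'`. (The slice of `c` in the box `γ` meets, at the
point `x` of `γ.P`, the tile of type `β` at its point `w`, iff `c - (x - w)` is in `β.C`.) -/
def ForcesBorder (𝓑' 𝓑 : Set (Box T)) : Prop :=
  ∀ γ ∈ 𝓑', ∀ c ∈ γ.C, ∀ c₁ ∈ γ.C, ∀ x ∈ γ.P, ∀ β ∈ 𝓑, ∀ w ∈ β.P,
    seen (x - w) c ∈ β.C → seen (x - w) c₁ ∈ β.C

/-- The data from which the expanding flattening sequence of `T` is built: a sequence of box
decompositions which starts with the one given by the prototiles, each being zoomed out of the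
previous one and forcing its border. -/
structure BoxSequence (T : Tiling X) where
  boxes : ℕ → Set (Box T)
  decomposition : ∀ n, IsBoxDecomposition (boxes n)
  zero : boxes 0 = prototileBoxes T
  zoomedOut : ∀ n, ZoomedOut (boxes (n + 1)) (boxes n)
  forcesBorder : ∀ n, ForcesBorder (boxes (n + 1)) (boxes n)

theorem seen_seen (x w : E d) (S : Hull T) : seen x (seen w S) = seen (x + w) S := by
  simp only [seen, vadd_vadd, neg_add]

namespace BoxSequence

variable (F : BoxSequence T)

/-- `S` and `S'` lie on the same vertical of the closure of a box of the `n`-th decomposition. -/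
def SameVertical (n : ℕ) (S S' : Hull T) : Prop :=
  ∃ β ∈ F.boxes n, ∃ x ∈ β.P, ∃ c ∈ β.C, ∃ c' ∈ β.C, S = seen x c ∧ S' = seen x c'

/-- The branched manifold `B_n`: the quotient of the hull by the equivalence relation generated by
lying on the same vertical of the closure of a box of the `n`-th decomposition; equivalently, the
prototiles of the `n`-th tiling glued along their boundaries whenever they are adjacent in some
tiling of the hull. -/
def Branched (n : ℕ) : Type := Quot (F.SameVertical n)

/-- The projection `π_n : Ω_T → B_n`. -/
def proj (n : ℕ) : Hull T → F.Branched n := Quot.mk _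

theorem proj_succ (n : ℕ) {S S' : Hull T} (h : F.SameVertical (n + 1) S S') :
    F.SameVertical n S S' := by
  obtain ⟨γ, hγ, x, hx, c, hc, c', hc', rfl, rfl⟩ := h
  have hcov : seen x c ∈ ⋃ β ∈ F.boxes n, β.cls := by
    rw [(F.decomposition n).cover]; trivial
  simp only [mem_iUnion] at hcov
  obtain ⟨β, hβ, w, hw, e, he, hxe⟩ := hcov
  have key : ∀ s : Hull T, seen w (seen (x - w) s) = seen x s := fun s => by
    rw [seen_seen, add_sub_cancel]
  have hec : seen (x - w) c = e := by
    have : seen (-w) (seen x c) = seen (-w) (seen w e) := by rw [hxe]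
    rw [seen_seen, seen_seen, neg_add_cancel] at this
    rw [sub_eq_neg_add, this]
    simp [seen]
  refine ⟨β, hβ, w, hw, seen (x - w) c, by rw [hec]; exact he, seen (x - w) c',
    F.forcesBorder n γ hγ c hc c' hc' x hx β hβ w hw (by rw [hec]; exact he), ?_, ?_⟩
  · rw [key]
  · rw [key]

theorem sameVertical_le {i j : ℕ} (h : i ≤ j) {S S' : Hull T} (hS : F.SameVertical j S S') :
    F.SameVertical i S S' := by
  induction h with
  | refl => exact hS
  | step _ ih => exact ih (F.proj_succ _ hS)

/-- The map `f_i ∘ ⋯ ∘ f_{j-1} : B_j → B_i` of the expanding flattening sequence; it is determined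
by its composition with `π_j` being `π_i`. -/
def bond {i j : ℕ} (h : i ≤ j) : F.Branched j → F.Branched i :=
  Quot.lift (F.proj i) fun _ _ hS => Quot.sound (F.sameVertical_le h hS)

theorem bond_proj {i j : ℕ} (h : i ≤ j) (S : Hull T) : F.bond h (F.proj j S) = F.proj i S := rfl

/-! ### De Rham cohomology of the branched manifolds -/

/-- Arbitrary fields of `k`-covectors on `B_n`, whose tangent bundle is trivialized by `ℝ^d`. -/
def Field (n k : ℕ) : Type := F.Branched n → E d [⋀^Fin k]→L[ℝ] ℝ

instance (n k : ℕ) : AddCommGroup (F.Field n k) :=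
  inferInstanceAs (AddCommGroup (F.Branched n → E d [⋀^Fin k]→L[ℝ] ℝ))

instance (n k : ℕ) : Module ℝ (F.Field n k) :=
  inferInstanceAs (Module ℝ (F.Branched n → E d [⋀^Fin k]→L[ℝ] ℝ))

/-- The reading of a form on `B_n` along the leaf of `S`. The smooth sheets of `B_n` are the images
of the leaves. -/
def along {n k : ℕ} (ω : F.Field n k) (S : Hull T) :
    E d → E d [⋀^Fin k]→L[ℝ] ℝ := fun x => ω (F.proj n (seen x S))

/-- Smooth `k`-forms on `B_n`. -/
def forms (n k : ℕ) : Submodule ℝ (F.Field n k) where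
  carrier := {ω | ∀ S, ContDiff ℝ ((⊤ : ℕ∞) : WithTop ℕ∞) (F.along ω S)}
  zero_mem' := fun _ => contDiff_const
  add_mem' := fun h h' S => (h S).add (h' S)
  smul_mem' := fun r _ h S => (h S).const_smul r

theorem forms_differentiable {n k : ℕ} {ω : F.Field n k}
    (h : ω ∈ F.forms n k) (S : Hull T) : Differentiable ℝ (F.along ω S) :=
  (h S).differentiable (by simp)

/-- Closed `k`-forms on `B_n`. -/
def closedForms (n k : ℕ) : Submodule ℝ (F.Field n k) where
  carrier := {ω | ω ∈ F.forms n k ∧ ∀ S x, extDeriv (F.along ω S) x = 0}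
  zero_mem' := by
    refine ⟨Submodule.zero_mem _, fun S x => ?_⟩
    have h := extDeriv_fun_smul (𝕜 := ℝ) (0 : ℝ) (fun _ : E d => (0 : E d [⋀^Fin k]→L[ℝ] ℝ))
      (x := x)
    simp only [zero_smul] at h
    exact h
  add_mem' := by
    rintro ω η ⟨h, hd⟩ ⟨h', hd'⟩
    refine ⟨Submodule.add_mem _ h h', fun S x => ?_⟩
    have := extDeriv_add (F.forms_differentiable h S x) (F.forms_differentiable h' S x)
    rw [hd, hd', add_zero] at this
    exact this
  smul_mem' := by
    rintro r ω ⟨h, hd⟩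
    refine ⟨Submodule.smul_mem _ r h, fun S x => ?_⟩
    have := extDeriv_smul (𝕜 := ℝ) r (F.along ω S) (x := x)
    rw [hd, smul_zero] at this
    exact this

/-- Exact `k`-forms on `B_n`. -/
def exactForms (n : ℕ) : (k : ℕ) → Submodule ℝ (F.Field n k)
  | 0 => ⊥
  | k + 1 =>
    { carrier := {ω | ∃ η ∈ F.forms n k, ∀ S x, F.along ω S x = extDeriv (F.along η S) x}
      zero_mem' := by
        refine ⟨0, Submodule.zero_mem _, fun S x => ?_⟩
        exact ((F.closedForms n k).zero_mem.2 S x).symm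
      add_mem' := by
        rintro ω ω' ⟨η, h, e⟩ ⟨η', h', e'⟩
        refine ⟨η + η', Submodule.add_mem _ h h', fun S x => ?_⟩
        have := extDeriv_add (F.forms_differentiable h S x) (F.forms_differentiable h' S x)
        rw [← e, ← e'] at this
        exact this.symm
      smul_mem' := by
        rintro r ω ⟨η, h, e⟩
        refine ⟨r • η, Submodule.smul_mem _ r h, fun S x => ?_⟩
        have := extDeriv_smul (𝕜 := ℝ) r (F.along η S) (x := x)
        rw [← e] at this
        exact this.symm }

/-- The de Rham cohomology `H^k_DR(B_n)`. -/
abbrev DeRham (n k : ℕ) : Type :=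
  F.closedForms n k ⧸ (F.exactForms n k).submoduleOf (F.closedForms n k)

/-- Pull-back of forms under `B_j → B_i`. -/
def pull {i j : ℕ} (h : i ≤ j) (k : ℕ) :
    F.Field i k →ₗ[ℝ] F.Field j k where
  toFun ω := fun b => ω (F.bond h b)
  map_add' _ _ := rfl
  map_smul' _ _ := rfl

theorem pull_forms {i j : ℕ} (h : i ≤ j) (k : ℕ) {ω} (hω : ω ∈ F.forms i k) :
    F.pull h k ω ∈ F.forms j k := fun S => hω S

theorem pull_closed {i j : ℕ} (h : i ≤ j) (k : ℕ) :
    ∀ ω ∈ F.closedForms i k, F.pull h k ω ∈ F.closedForms j k :=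
  fun _ hω => ⟨F.pull_forms h k hω.1, fun S x => hω.2 S x⟩

theorem pull_exact {i j : ℕ} (h : i ≤ j) :
    ∀ k, ∀ ω ∈ F.exactForms i k, F.pull h k ω ∈ F.exactForms j k
  | 0, ω, hω => by
    have : ω = 0 := hω
    rw [this, map_zero]
    exact Submodule.zero_mem _
  | k + 1, _, ⟨η, hη, e⟩ => ⟨F.pull h k η, F.pull_forms h k hη, fun S x => e S x⟩

/-- The map `H^k_DR(B_i) → H^k_DR(B_j)` induced by `B_j → B_i`. -/
def pullDeRham (k : ℕ) (i j : ℕ) (h : i ≤ j) : F.DeRham i k →ₗ[ℝ] F.DeRham j k :=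
  Submodule.mapQ _ _ ((F.pull h k).restrict (F.pull_closed h k)) fun ω hω =>
    F.pull_exact h k ω.1 hω

/-- The de Rham cohomology `H^k_DR(Ω(F))`, the direct limit of the `H^k_DR(B_n)`. -/
abbrev DeRhamLimit (k : ℕ) : Type :=
  Module.DirectLimit (fun n => F.DeRham n k) (F.pullDeRham k)

/-- The class on `B_n` of a closed form. -/
def formClass (n k : ℕ) (ω : F.closedForms n k) : F.DeRham n k := Submodule.Quotient.mk ω

/-- The canonical map `H^k_DR(B_n) → H^k_DR(Ω(F))`. -/
def toLimit (n k : ℕ) : F.DeRham n k →ₗ[ℝ] F.DeRhamLimit k :=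
  Module.DirectLimit.of ℝ ℕ (fun n => F.DeRham n k) (F.pullDeRham k) n

/-! ### Cellular cycles and integral classes -/

/-- The `d`-regions of `B_n`: they are copies of prototiles in `X`, given by a box `(P, C)` of the
`n`-th decomposition and a tile, contained in `P`, of the tilings in `C`. -/
structure Region (n : ℕ) where
  box : Box T
  tile : Set (E d)
  box_mem : box ∈ F.boxes n
  tile_subset : tile ⊆ box.P
  tile_mem : ∃ c ∈ box.C, tile ∈ c.tiles

variable {F}

/-- The parametrization of (the closure of) a `d`-region by its tile; it does not depend on the
chosen tiling in the vertical of the box. -/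
def Region.param {n : ℕ} (R : F.Region n) (x : E d) : F.Branched n :=
  F.proj n (seen x R.tile_mem.choose)

/-- `x` is in the relative interior of the face of the rectangle `t` on which the `k`-th coordinate
is largest. -/
def IsUpper (k : Fin d) (t : Set (E d)) (x : E d) : Prop :=
  ∃ a b : E d, (∀ i, a i < b i) ∧ t = rect a b ∧ x k = b k ∧ ∀ i, i ≠ k → a i < x i ∧ x i < b i

/-- `x` is in the relative interior of the face of the rectangle `t` on which the `k`-th coordinate
is smallest. -/
def IsLower (k : Fin d) (t : Set (E d)) (x : E d) : Prop :=
  ∃ a b : E d, (∀ i, a i < b i) ∧ t = rect a b ∧ x k = a k ∧ ∀ i, i ≠ k → a i < x i ∧ x i < b i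

/-- The germs of closed `d`-regions at `b`. -/
def germs {n : ℕ} (b : F.Branched n) : Set (F.Region n × E d) :=
  {r | r.2 ∈ r.1.tile ∧ r.1.param r.2 = b}

/-- `b` lies in a `(d-1)`-cell of `B_n` orthogonal to the `k`-th axis: there are finitely many
germs of `d`-regions at `b`, and each is bounded at `b` by an open face orthogonal to this axis. -/
def IsFacetPoint {n : ℕ} (k : Fin d) (b : F.Branched n) : Prop :=
  (germs b).Finite ∧ ∀ r ∈ germs b, IsUpper k r.1.tile r.2 ∨ IsLower k r.1.tile r.2

/-- Integral `d`-cycles of `B_n`: integral `d`-chains whose boundary vanishes, that is, along every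
`(d-1)`-cell the coefficients of the germs of `d`-regions on the two sides have the same sum. -/
def IsCycle {n : ℕ} (c : F.Region n →₀ ℤ) : Prop :=
  ∀ (k : Fin d) (b : F.Branched n), IsFacetPoint k b →
    ∑ᶠ r ∈ {r ∈ germs b | IsUpper k r.1.tile r.2}, c r.1 =
      ∑ᶠ r ∈ {r ∈ germs b | IsLower k r.1.tile r.2}, c r.1

/-- The integral of a `d`-form on `B_n` over a `d`-region. -/
def Region.integral {n : ℕ} (R : F.Region n) (ω : F.Field n d) : ℝ :=
  ∫ x in R.tile, coeff (ω (R.param x))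

/-- The integral of a `d`-form over an integral `d`-chain. -/
def chainIntegral {n : ℕ} (c : F.Region n →₀ ℤ) (ω : F.Field n d) : ℝ :=
  c.sum fun R m => (m : ℝ) * R.integral ω

variable (F)

/-- The integral classes in `H^d_DR(B_n)`: those with integer values on integral cycles. -/
def integralClasses (n : ℕ) : Set (F.DeRham n d) :=
  F.formClass n d '' {ω | ∀ c : F.Region n →₀ ℤ, IsCycle c → ∃ m : ℤ, chainIntegral c ω.1 = m}

/-- The integral classes in `H^d_DR(Ω(F))`: the direct limit of the integral classes of the
`B_n`. -/
def integralLimit : Set (F.DeRhamLimit d) := ⋃ n, F.toLimit n d '' F.integralClasses n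

end BoxSequence

end TilingHull

end

open TilingHull

/-!
# Values of the Ruelle–Sullivan current on integral classes

For a finite invariant measure `μ` on the hull, disintegration of `μ` in charts
(`Chart.comap_map_eq_prod`) shows that the Ruelle–Sullivan current of a leafwise `d`-form `ω` is
the integral over the hull of the coefficient of `ω` (`ruelleSullivan_eq_integral`). It kills exact
forms, because derivatives along the leaves have integral zero for an invariant measure
(`integral_fderiv_leaf`), so that it defines a linear form on the direct limit of the cohomologies
(`BoxSequence.currentLimit`).

The regions of `B_n` cut the hull, up to a null set, into products `interior t × C`. Hence the
current of a form on `B_n` is its integral over the real chain whose coefficients are the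
transverse masses of the regions (`BoxSequence.integral_coeff_eq_sum`), and by invariance of `μ`
this chain is a cycle (`BoxSequence.mass_isCycle`).

*Integral classes give integrals of integer functions.* The group generated by the masses is free.
In a basis of it, the cycle of masses is a combination of integral cycles, on which an integral
class has integer values. So the value of the current lies in the group generated by the masses
(`BoxSequence.exists_int_combination_mass`), and each mass is the measure of a clopen subset of the
canonical transversal (`BoxSequence.Region.exists_indicator`).

*Integer functions come from integral classes.* Border forcing implies that the decompositions
separate the points of the hull (`BoxSequence.eq_of_forall_sameVertical`). By compactness, a
continuous integer function `f` on the canonical transversal is constant on the verticals of some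
decomposition `n` (`BoxSequence.exists_level`). Spreading `f` around the transversal by means of a
bump function of integral `1` yields a `d`-form on `B_n` whose integral over each region is a value
of `f`, hence an integral class, and whose current is the integral of `f`
(`BoxSequence.exists_integral_form`).
-/

namespace TilingHull

variable {d : ℕ} {X : Set (Set (E d))} {T : Tiling X}

/-! ### Rectangles -/

theorem vadd_rect (v a b : E d) : v +ᵥ rect a b = rect (v + a) (v + b) := by
  ext x
  rw [mem_vadd_set_iff_neg_vadd_mem]
  simp only [rect, mem_ofPred_eq, vadd_eq_add, PiLp.add_apply, PiLp.neg_apply]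
  refine forall_congr' fun i => ⟨fun h => ⟨?_, ?_⟩, fun h => ⟨?_, ?_⟩⟩ <;> linarith [h.1, h.2]

theorem IsRect.vadd {p : Set (E d)} (h : IsRect p) (v : E d) : IsRect (v +ᵥ p) := by
  obtain ⟨a, b, hab, rfl⟩ := h
  exact ⟨v + a, v + b, fun i => by simpa using hab i, vadd_rect v a b⟩

theorem convex_rect (a b : E d) : Convex ℝ (rect a b) := by
  have : rect a b = ⋂ i, (fun x : E d => x i) ⁻¹' Icc (a i) (b i) := by
    ext x; simp [rect]
  rw [this]
  exact convex_iInter fun i =>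
    (convex_Icc (a i) (b i)).is_linear_preimage ⟨fun _ _ => rfl, fun _ _ => rfl⟩

theorem isCompact_rect (a b : E d) : IsCompact (rect a b) := by
  have h : rect a b = (EuclideanSpace.equiv (Fin d) ℝ).toHomeomorph ⁻¹' Icc a b := by
    ext x
    simp only [rect, mem_ofPred_eq, mem_preimage, mem_Icc, Pi.le_def]
    exact ⟨fun h => ⟨fun i => (h i).1, fun i => (h i).2⟩, fun h i => ⟨h.1 i, h.2 i⟩⟩
  rw [h]
  exact (Homeomorph.isCompact_preimage _).2 isCompact_Icc

theorem mem_interior_rect {a b x : E d} (h : ∀ i, a i < x i ∧ x i < b i) :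
    x ∈ interior (rect a b) := by
  have ho : IsOpen {x : E d | ∀ i, a i < x i ∧ x i < b i} := by
    simp only [ofPred_forall]
    refine isOpen_iInter_of_finite fun i => ?_
    have hc : Continuous fun x : E d => x i := by fun_prop
    exact (isOpen_lt continuous_const hc).inter (isOpen_lt hc continuous_const)
  exact interior_maximal (fun z hz i => ⟨(hz i).1.le, (hz i).2.le⟩) ho h

namespace IsRect

variable {p : Set (E d)} (h : IsRect p)
include h

theorem isCompact : IsCompact p := by
  obtain ⟨a, b, -, rfl⟩ := h; exact isCompact_rect a b

theorem isClosed : IsClosed p := h.isCompact.isClosed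

theorem convex : Convex ℝ p := by
  obtain ⟨a, b, -, rfl⟩ := h; exact convex_rect a b

theorem interior_nonempty : (interior p).Nonempty := by
  obtain ⟨a, b, hab, rfl⟩ := h
  refine ⟨(2⁻¹ : ℝ) • (a + b), mem_interior_rect fun i => ?_⟩
  have := hab i
  simp only [PiLp.smul_apply, PiLp.add_apply, smul_eq_mul]
  constructor <;> linarith

theorem nonempty : p.Nonempty := h.interior_nonempty.mono interior_subset

theorem closure_interior : closure (interior p) = p := by
  rw [h.convex.closure_interior_eq_closure_of_nonempty_interior h.interior_nonempty,
    h.isClosed.closure_eq]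

theorem vadd_injective {v w : E d} (hvw : v +ᵥ p = w +ᵥ p) : v = w := by
  obtain ⟨a, b, hab, rfl⟩ := h
  rw [vadd_rect, vadd_rect] at hvw
  have h1 : v + a ∈ rect (w + a) (w + b) := by
    rw [← hvw]; exact fun i => ⟨le_rfl, by simpa using (hab i).le⟩
  have h2 : w + a ∈ rect (v + a) (v + b) := by
    rw [hvw]; exact fun i => ⟨le_rfl, by simpa using (hab i).le⟩
  ext i
  have h1 := (h1 i).1
  have h2 := (h2 i).1
  simp only [PiLp.add_apply] at h1 h2
  linarith

theorem volume_frontier : volume (frontier p) = 0 := h.convex.addHaar_frontier volume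

end IsRect

namespace IsBlock

variable {P : Set (E d)} (h : IsBlock P)
include h

theorem isCompact : IsCompact P := by
  obtain ⟨-, R, hR, hr, rfl⟩ := h
  exact hR.isCompact_sUnion fun p hp => (hr p hp).isCompact

theorem isClosed : IsClosed P := h.isCompact.isClosed

theorem subset_closure_interior : P ⊆ closure (interior P) := by
  obtain ⟨-, R, hR, hr, rfl⟩ := h
  refine sUnion_subset fun p hp => ?_
  rw [← (hr p hp).closure_interior]
  exact closure_mono (interior_mono (subset_sUnion_of_mem hp))

end IsBlock

/-! ### The topology of the space of tilings -/

namespace Tiling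

theorem closeness_self (S : Tiling X) {ε : ℝ} (h0 : 0 < ε) (h1 : ε < 1) : ε ∈ closeness S S :=
  ⟨h0, h1, 0, by simp [h0.le], 0, by simp [h0.le], rfl⟩

theorem closeness_symm {S R : Tiling X} {ε : ℝ} (h : ε ∈ closeness S R) : ε ∈ closeness R S := by
  obtain ⟨h0, h1, x, hx, y, hy, e⟩ := h
  exact ⟨h0, h1, y, hy, x, hx, e.symm⟩

/-- Tilings which agree on a set up to translations, agree on smaller sets after a further
translation. -/
theorem trace_vadd_eq {S R : Tiling X} {K L : Set (E d)} (v : E d) (h : S.trace K = R.trace K)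
    (hL : L ⊆ v +ᵥ K) : (v +ᵥ S).trace L = (v +ᵥ R).trace L := by
  rw [trace_inter _ hL, trace_inter _ hL, trace_vadd, trace_vadd, h]

theorem closedBall_subset_vadd {v : E d} {a b : ℝ} (h : a + ‖v‖ ≤ b) :
    Metric.closedBall (0 : E d) a ⊆ v +ᵥ Metric.closedBall (0 : E d) b := by
  intro z hz
  rw [mem_vadd_set_iff_neg_vadd_mem, mem_closedBall_zero_iff]
  rw [mem_closedBall_zero_iff] at hz
  calc ‖-v + z‖ ≤ ‖-v‖ + ‖z‖ := norm_add_le _ _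
    _ ≤ b := by rw [norm_neg]; linarith

theorem closeness_mono {S R : Tiling X} {a b : ℝ} (h : a ∈ closeness S R) (hab : a ≤ b)
    (hb : b < 1) : b ∈ closeness S R := by
  obtain ⟨h0, h1, x, hx, y, hy, e⟩ := h
  refine ⟨h0.trans_le hab, hb, x, Metric.closedBall_subset_closedBall hab hx, y,
    Metric.closedBall_subset_closedBall hab hy, ?_⟩
  have hs : Metric.closedBall (0 : E d) (1 / b) ⊆ Metric.closedBall (0 : E d) (1 / a) :=
    Metric.closedBall_subset_closedBall (one_div_le_one_div_of_le h0 hab)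
  rw [trace_inter _ hs, trace_inter _ hs, e]

/-- The weak triangle inequality for the tiling distance. -/
theorem closeness_trans {S R Q : Tiling X} {a : ℝ} (ha : a < 1 / 2) (h : a ∈ closeness S R)
    (h' : a ∈ closeness R Q) : 2 * a ∈ closeness S Q := by
  obtain ⟨h0, h1, x, hx, y, hy, e⟩ := h
  obtain ⟨-, -, z, hz, w, hw, e'⟩ := h'
  rw [mem_closedBall_zero_iff] at hx hy hz hw
  have hr : 1 / (2 * a) + a ≤ 1 / a := by
    rw [one_div, one_div, mul_inv]
    have : a * a⁻¹ = 1 := mul_inv_cancel₀ h0.ne'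
    have hi : 0 < a⁻¹ := inv_pos.2 h0
    nlinarith
  refine ⟨by linarith, by linarith, z + x, ?_, y + w, ?_, ?_⟩
  · rw [mem_closedBall_zero_iff]
    exact (norm_add_le _ _).trans (by linarith)
  · rw [mem_closedBall_zero_iff]
    exact (norm_add_le _ _).trans (by linarith)
  · have e1 := trace_vadd_eq z e (closedBall_subset_vadd (a := 1 / (2 * a)) (by linarith))
    have e2 := trace_vadd_eq y e' (closedBall_subset_vadd (a := 1 / (2 * a)) (by linarith))
    rw [vadd_vadd, vadd_vadd] at e1 e2
    rw [e1, ← e2, add_comm]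

theorem exists_closeness_of_dist_lt {S R : Tiling X} {ε : ℝ} (hε : ε ≤ 1) (h : dist S R < ε) :
    ∃ a < ε, a ∈ closeness S R := by
  unfold dist at h
  split_ifs at h with hne
  · obtain ⟨a, ha, hlt⟩ := exists_lt_of_csInf_lt hne h
    exact ⟨a, hlt, ha⟩
  · linarith

/-- The closeness relations define a neighbourhood basis; that they are neighbourhoods follows from
the weak triangle inequality. -/
theorem mem_nhds_iff_closeness {S : Tiling X} {U : Set (Tiling X)} :
    U ∈ 𝓝 S ↔ ∃ ε, 0 < ε ∧ ε < 1 ∧ ∀ R, ε ∈ closeness S R → R ∈ U := by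
  constructor
  · intro h
    obtain ⟨V, hVU, hV, hS⟩ := mem_nhds_iff.1 h
    obtain ⟨ε, hε, hB⟩ := hV S hS
    have hm : 0 < min ε 1 := lt_min hε one_pos
    refine ⟨min ε 1 / 2, by positivity, by linarith [min_le_right ε 1], fun R hR => hVU (hB R ?_)⟩
    rw [dist, if_pos ⟨_, hR⟩]
    refine (csInf_le ⟨0, fun z hz => hz.1.le⟩ hR).trans_lt ?_
    linarith [min_le_left ε 1]
  · rintro ⟨ε, h0, h1, hU⟩
    refine mem_nhds_iff.2
      ⟨{S | ∃ ε, 0 < ε ∧ ε < 1 ∧ ∀ R, ε ∈ closeness S R → R ∈ U}, ?_, ?_, ⟨ε, h0, h1, hU⟩⟩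
    · rintro R ⟨a, ha0, ha1, hR⟩
      exact hR R (closeness_self R ha0 ha1)
    · rintro R ⟨a, ha0, ha1, hR⟩
      refine ⟨a / 2, by positivity, fun Q hQ => ⟨a / 2, by positivity, by linarith, ?_⟩⟩
      intro Q' hQ'
      apply hR
      have hQ : a / 2 ∈ closeness R Q := by
        obtain ⟨b, hb, h⟩ := exists_closeness_of_dist_lt (by linarith) hQ
        exact closeness_mono h hb.le (by linarith)
      have := closeness_trans (by linarith) hQ hQ'
      rwa [mul_div_cancel₀ _ two_ne_zero] at this

theorem continuous_vadd_prod : Continuous fun q : E d × Tiling X => q.1 +ᵥ q.2 := by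
  rw [continuous_iff_continuousAt]
  rintro ⟨v, S⟩ U hU
  obtain ⟨ε, h0, h1, hε⟩ := mem_nhds_iff_closeness.1 hU
  -- `1 / η ≥ 1 / ε + ‖v‖` leaves room for the translation by `v`
  set η : ℝ := min (ε / 2) (1 / (1 / ε + ‖v‖)) with hη
  have hden : 0 < 1 / ε + ‖v‖ := by positivity
  have hη0 : 0 < η := by positivity
  have hη1 : η ≤ ε / 2 := min_le_left _ _
  have hη2 : 1 / ε + ‖v‖ ≤ 1 / η := by
    rw [le_one_div hden hη0]
    exact min_le_right _ _
  have hS : {R | η ∈ closeness S R} ∈ 𝓝 S :=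
    mem_nhds_iff_closeness.2 ⟨η, hη0, by linarith, fun _ h => h⟩
  have hv : Metric.closedBall v η ∈ 𝓝 v := Metric.closedBall_mem_nhds v hη0
  refine Filter.mem_map.2 (Filter.mem_of_superset (prod_mem_nhds hv hS) ?_)
  rintro ⟨w, R⟩ ⟨hw, hR⟩
  apply hε
  obtain ⟨-, -, x, hx, y, hy, e⟩ := hR
  rw [mem_closedBall_zero_iff] at hx hy
  have hw : ‖w - v‖ ≤ η := by rwa [← dist_eq_norm]
  refine ⟨h0, h1, x, by rw [mem_closedBall_zero_iff]; linarith, y + v - w, ?_, ?_⟩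
  · rw [mem_closedBall_zero_iff]
    calc ‖y + v - w‖ = ‖y - (w - v)‖ := by congr 1; abel
      _ ≤ ‖y‖ + ‖w - v‖ := norm_sub_le _ _
      _ ≤ ε := by linarith
  · have := trace_vadd_eq v e (closedBall_subset_vadd hη2)
    rw [vadd_vadd, vadd_vadd] at this
    rw [vadd_vadd, vadd_vadd, add_comm x, this]
    congr 2
    abel

theorem isRect_of_mem (hX : ∀ p ∈ X, IsRect p) (S : Tiling X) {t : Set (E d)} (ht : t ∈ S.tiles) :
    IsRect t := by
  obtain ⟨p, hp, u, rfl⟩ := S.type_mem t ht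
  exact (hX p hp).vadd u

theorem eq_of_mem_interior (hX : ∀ p ∈ X, IsRect p) (S : Tiling X) {s t : Set (E d)}
    (hs : s ∈ S.tiles) (ht : t ∈ S.tiles) {x : E d} (hxs : x ∈ interior s) (hxt : x ∈ t) :
    s = t := by
  by_contra hne
  rw [← (S.isRect_of_mem hX ht).closure_interior] at hxt
  obtain ⟨z, hz⟩ := mem_closure_iff.1 hxt _ isOpen_interior hxs
  exact (S.disjoint s hs t ht hne).le_bot hz

/-- A tile of `S` is, up to a small translation, a tile of every tiling close to `S`. -/
theorem exists_tile_of_closeness (hX : ∀ p ∈ X, IsRect p) {S R : Tiling X} {t : Set (E d)}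
    (ht : t ∈ S.tiles) {ρ ε : ℝ} (hρ : t ⊆ Metric.closedBall 0 ρ) (hε : ρ + 2 ≤ 1 / ε)
    (h : ε ∈ closeness S R) : ∃ v : E d, ‖v‖ ≤ 2 * ε ∧ v +ᵥ t ∈ R.tiles := by
  obtain ⟨h0, h1, x, hx, y, hy, e⟩ := h
  rw [mem_closedBall_zero_iff] at hx hy
  have hsub : x +ᵥ t ⊆ Metric.closedBall 0 (ρ + 1) := by
    rintro _ ⟨z, hz, rfl⟩
    have := hρ hz
    rw [mem_closedBall_zero_iff] at this ⊢
    exact (norm_add_le _ _).trans (by linarith)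
  have hmem : (x +ᵥ t) ∩ Metric.closedBall 0 (1 / ε) ∈
      (x +ᵥ S).trace (Metric.closedBall 0 (1 / ε)) := ⟨x +ᵥ t, ⟨t, ht, rfl⟩, rfl⟩
  rw [e, inter_eq_self_of_subset_left
    (hsub.trans (Metric.closedBall_subset_closedBall (by linarith)))] at hmem
  obtain ⟨s, hs, hse⟩ := hmem
  change s ∩ _ = _ at hse
  have hsr := isRect_of_mem hX (y +ᵥ R) hs
  have htr := (isRect_of_mem hX S ht).vadd x
  -- the connected set `s` cannot leave the ball, as it does not meet the shell around its trace
  have hsB : s ⊆ Metric.ball 0 (ρ + 2) := by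
    refine hsr.convex.isPreconnected.subset_left_of_subset_union (u := Metric.ball 0 (ρ + 2))
      (v := (Metric.closedBall 0 (1 / ε))ᶜ) Metric.isOpen_ball
      Metric.isClosed_closedBall.isOpen_compl ?_ ?_ ?_
    · exact disjoint_compl_right_iff_subset.2
        (Metric.ball_subset_closedBall.trans (Metric.closedBall_subset_closedBall hε))
    · intro z hz
      by_cases hzB : z ∈ Metric.closedBall 0 (1 / ε)
      · left
        exact Metric.closedBall_subset_ball (by linarith) (hsub (hse ▸ ⟨hz, hzB⟩))
      · exact Or.inr hzB
    · obtain ⟨z, hz⟩ := htr.nonempty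
      have hz' : z ∈ s ∩ Metric.closedBall 0 (1 / ε) := hse ▸ hz
      exact ⟨z, hz'.1, Metric.closedBall_subset_ball (by linarith) (hsub hz)⟩
  obtain ⟨s', hs', rfl⟩ := hs
  rw [inter_eq_self_of_subset_left
    (hsB.trans (Metric.ball_subset_closedBall.trans
      (Metric.closedBall_subset_closedBall hε)))] at hse
  refine ⟨-y + x, ?_, ?_⟩
  · exact (norm_add_le _ _).trans (by rw [norm_neg]; linarith)
  · rw [← vadd_vadd, ← hse]
    change -y +ᵥ (y +ᵥ s') ∈ _
    rwa [neg_vadd_vadd]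

/-- Tilings at distance `0` have the same tiles: the small translations which carry a tile of `S`
to a tile of `R` all vanish, since the translates of a tile by two small vectors overlap. -/
theorem tiles_subset_of_closeness (hX : ∀ p ∈ X, IsRect p) {S R : Tiling X}
    (h : ∀ ε, 0 < ε → ε < 1 → ε ∈ closeness S R) : S.tiles ⊆ R.tiles := by
  intro t ht
  have hr := isRect_of_mem hX S ht
  obtain ⟨ρ, hρ0, hρ⟩ := hr.isCompact.isBounded.subset_closedBall_lt 0 0
  obtain ⟨z, hz⟩ := hr.interior_nonempty
  obtain ⟨s, hs0, hs⟩ := Metric.isOpen_iff.1 isOpen_interior z hz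
  have key : ∀ η > 0, ∃ v : E d, ‖v‖ < η ∧ v +ᵥ t ∈ R.tiles := by
    intro η hη
    have h2 : 0 < ρ + 2 := by linarith
    set ε := min (1 / (ρ + 2)) (η / 3) with hε
    have hε0 : 0 < ε := by positivity
    have hε1 : ε ≤ 1 / (ρ + 2) := min_le_left _ _
    have hε2 : ε ≤ η / 3 := min_le_right _ _
    have hε3 : 1 / (ρ + 2) < 1 := by rw [div_lt_one h2]; linarith
    obtain ⟨v, hv, hvt⟩ := exists_tile_of_closeness hX ht hρ
      ((le_one_div h2 hε0).2 hε1) (h ε hε0 (by linarith))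
    exact ⟨v, by linarith, hvt⟩
  obtain ⟨v, hv, hvt⟩ := key s hs0
  by_cases hv0 : v = 0
  · rwa [hv0, zero_vadd] at hvt
  exfalso
  obtain ⟨w, hw, hwt⟩ := key (min s ‖v‖) (lt_min hs0 (norm_pos_iff.2 hv0))
  have hint : ∀ u : E d, ‖u‖ < s → z ∈ interior (u +ᵥ t) := by
    intro u hu
    rw [interior_vadd, mem_vadd_set_iff_neg_vadd_mem]
    apply hs
    simpa [dist_eq_norm] using hu
  have hvw : v +ᵥ t = w +ᵥ t := eq_of_mem_interior hX R hvt hwt (hint v hv)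
    (interior_subset (hint w (hw.trans_le (min_le_left _ _))))
  have := hr.vadd_injective hvw
  rw [← this] at hw
  exact lt_irrefl _ (hw.trans_le (min_le_right _ _))

theorem t2Space (hX : ∀ p ∈ X, IsRect p) : T2Space (Tiling X) := by
  refine ⟨fun S R hne => ?_⟩
  obtain ⟨ε, h0, h1, hε⟩ : ∃ ε, 0 < ε ∧ ε < 1 ∧ ε ∉ closeness S R := by
    by_contra! hcon
    exact hne (Tiling.ext (Subset.antisymm (tiles_subset_of_closeness hX hcon)
      (tiles_subset_of_closeness hX fun ε h0 h1 => closeness_symm (hcon ε h0 h1))))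
  have hn : ∀ S : Tiling X, {R | ε / 2 ∈ closeness S R} ∈ 𝓝 S := fun S =>
    mem_nhds_iff_closeness.2 ⟨ε / 2, by positivity, by linarith, fun _ h => h⟩
  obtain ⟨U, hU, hUo, hSU⟩ := mem_nhds_iff.1 (hn S)
  obtain ⟨V, hV, hVo, hRV⟩ := mem_nhds_iff.1 (hn R)
  refine ⟨U, V, hUo, hVo, hSU, hRV, disjoint_left.2 fun Q hQU hQV => hε ?_⟩
  have := closeness_trans (by linarith) (hU hQU) (closeness_symm (hV hQV))
  rwa [mul_div_cancel₀ _ two_ne_zero] at this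

/-- Bounded sets meet finitely many tiles, since the tiles have bounded diameter and contain
disjoint balls of a common radius. -/
theorem finite_tiles_inter (hXfin : X.Finite) (hX : ∀ p ∈ X, IsRect p) (S : Tiling X)
    {K : Set (E d)} (hK : Bornology.IsBounded K) : {t ∈ S.tiles | (t ∩ K).Nonempty}.Finite := by
  obtain ⟨D, hD⟩ : ∃ D : ℝ, ∀ p ∈ X, Metric.diam p ≤ D := by
    have : ∀ᶠ D : ℝ in Filter.atTop, ∀ p ∈ X, Metric.diam p ≤ D :=
      (Filter.eventually_all_finite hXfin).2 fun p _ => Filter.eventually_ge_atTop _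
    exact this.exists
  obtain ⟨ε, hε, hε0⟩ : ∃ ε : ℝ, (∀ p ∈ X, ∃ z, Metric.ball z ε ⊆ p) ∧ 0 < ε := by
    have : ∀ᶠ ε : ℝ in 𝓝[>] 0, ∀ p ∈ X, ∃ z, Metric.ball z ε ⊆ p := by
      refine (Filter.eventually_all_finite hXfin).2 fun p hp => ?_
      obtain ⟨z, hz⟩ := (hX p hp).interior_nonempty
      obtain ⟨s, hs0, hs⟩ := Metric.isOpen_iff.1 isOpen_interior z hz
      filter_upwards [Ioo_mem_nhdsGT hs0] with ε hε
      exact ⟨z, (Metric.ball_subset_ball hε.2.le).trans (hs.trans interior_subset)⟩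
    exact (this.and self_mem_nhdsWithin).exists
  obtain ⟨ρ, hρ⟩ := hK.subset_closedBall 0
  set A := {t ∈ S.tiles | (t ∩ K).Nonempty}
  have htD : ∀ t ∈ A, t ⊆ Metric.closedBall 0 (ρ + D) := by
    rintro t ⟨ht, z, hzt, hzK⟩ x hx
    have hb := (S.isRect_of_mem hX ht).isCompact.isBounded
    have h1 : Metric.diam t ≤ D := by
      obtain ⟨p, hp, u, rfl⟩ := S.type_mem t ht
      rw [show Metric.diam (u +ᵥ p) = Metric.diam p from
        (isometry_vadd (E d) u).diam_image p]
      exact hD p hp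
    have h2 := Metric.dist_le_diam_of_mem hb hx hzt
    have h3 := hρ hzK
    rw [Metric.mem_closedBall] at h3 ⊢
    linarith [dist_triangle x z 0]
  have hfin := Measure.finite_const_le_meas_of_disjoint_iUnion (ι := A) (volume : Measure (E d))
    (ε := volume (Metric.ball (0 : E d) ε)) (As := fun t => interior t.1)
    (Metric.measure_ball_pos _ _ hε0) (fun t => isOpen_interior.measurableSet)
    (fun s t hst => S.disjoint s s.2.1 t t.2.1 fun h => hst (Subtype.ext h))
    (ne_top_of_le_ne_top (measure_closedBall_lt_top (x := (0 : E d)) (r := ρ + D)).ne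
      (measure_mono (iUnion_subset fun t => interior_subset.trans (htD t t.2))))
  refine (hfin.image Subtype.val).subset fun t ht => ⟨⟨t, ht⟩, ?_, rfl⟩
  obtain ⟨p, hp, u, rfl⟩ := S.type_mem t ht.1
  obtain ⟨z, hz⟩ := hε p hp
  calc volume (Metric.ball (0 : E d) ε) = volume (Metric.ball z ε) :=
        (Measure.addHaar_ball_center volume z ε).symm
    _ ≤ volume (interior p) := measure_mono (interior_maximal hz Metric.isOpen_ball)
    _ = volume (interior (u +ᵥ p)) := by rw [interior_vadd, measure_vadd]

/-- The union of any family of tiles of a tiling is closed. -/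
theorem isClosed_sUnion_tiles (hXfin : X.Finite) (hX : ∀ p ∈ X, IsRect p) (S : Tiling X)
    {A : Set (Set (E d))} (hA : A ⊆ S.tiles) : IsClosed (⋃₀ A) := by
  rw [sUnion_eq_iUnion]
  refine LocallyFinite.isClosed_iUnion (fun x => ⟨Metric.ball x 1, Metric.ball_mem_nhds _ one_pos,
    ?_⟩) fun t => (S.isRect_of_mem hX (hA t.2)).isClosed
  refine Finite.of_finite_image ((finite_tiles_inter hXfin hX S (Metric.isBounded_ball
    (x := x) (r := 1))).subset ?_) Subtype.val_injective.injOn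
  rintro _ ⟨t, ht, rfl⟩
  exact ⟨hA t.2, ht⟩

end Tiling

/-! ### The hull and its leaves -/

theorem continuous_seen : Continuous fun q : E d × Hull T => seen q.1 q.2 :=
  (Tiling.continuous_vadd_prod.comp (continuous_fst.neg.prodMk
    (continuous_subtype_val.comp continuous_snd))).subtype_mk _

theorem continuous_seen_left (S : Hull T) : Continuous fun x : E d => seen x S :=
  continuous_seen.comp (Continuous.prodMk_left S)

theorem continuous_seen_right (x : E d) : Continuous fun S : Hull T => seen x S :=
  continuous_seen.comp (Continuous.prodMk_right x)

theorem Hull.t2Space (hX : ∀ p ∈ X, IsRect p) : T2Space (Hull T) :=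
  have := Tiling.t2Space hX
  inferInstanceAs (T2Space {S // S ∈ closure T.orbit})

@[simp]
theorem seen_zero (S : Hull T) : seen (0 : E d) S = S := by simp [seen]

theorem seen_injective (x : E d) : Function.Injective (seen x : Hull T → Hull T) :=
  AddAction.injective (-x)

theorem mem_tiles_seen {x : E d} {S : Hull T} {t : Set (E d)} :
    t ∈ (seen x S).tiles ↔ x +ᵥ t ∈ S.tiles := by
  change t ∈ (fun t => -x +ᵥ t) '' S.tiles ↔ _
  constructor
  · rintro ⟨s, hs, rfl⟩
    simpa using hs
  · intro h
    exact ⟨_, h, by simp⟩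

theorem Hull.isRect (hX : ∀ p ∈ X, IsRect p) (S : Hull T) {t : Set (E d)} (ht : t ∈ S.tiles) :
    IsRect t := S.1.isRect_of_mem hX ht

theorem Hull.exists_tile (S : Hull T) (x : E d) : ∃ t ∈ S.tiles, x ∈ t := by
  have : x ∈ ⋃₀ S.1.tiles := by rw [S.1.cover]; trivial
  exact this

theorem Hull.tile_eq (hX : ∀ p ∈ X, IsRect p) (S : Hull T) {s t : Set (E d)}
    (hs : s ∈ S.tiles) (ht : t ∈ S.tiles) {x : E d} (hxs : x ∈ interior s) (hxt : x ∈ t) :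
    s = t := S.1.eq_of_mem_interior hX hs ht hxs hxt

theorem Hull.ext_tiles {S S' : Hull T} (h : S.tiles = S'.tiles) : S = S' :=
  Subtype.ext (Tiling.ext h)

namespace BoxSequence

variable (F : BoxSequence T)

/-! ### Tiles of the successive decompositions -/

theorem exists_mem_cls (n : ℕ) (S : Hull T) :
    ∃ β ∈ F.boxes n, ∃ x ∈ β.P, ∃ c ∈ β.C, S = seen x c := by
  have hcov : S ∈ ⋃ β ∈ F.boxes n, β.cls := by
    rw [(F.decomposition n).cover]; trivial
  simp only [mem_iUnion, exists_prop] at hcov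
  exact hcov

variable {F}

theorem box_unique {n : ℕ} {β γ : Box T} (hβ : β ∈ F.boxes n) (hγ : γ ∈ F.boxes n)
    {x w : E d} (hx : x ∈ interior β.P) (hw : w ∈ interior γ.P) {c e : Hull T} (hc : c ∈ β.C)
    (he : e ∈ γ.C) (h : seen x c = seen w e) : β = γ ∧ x = w ∧ c = e := by
  have hβγ : β = γ := by
    by_contra hne
    exact ((F.decomposition n).disjoint β hβ γ hγ hne).le_bot
      ⟨⟨x, hx, c, hc, rfl⟩, ⟨w, hw, e, he, h⟩⟩
  subst hβγ
  have := ((F.decomposition n).isBox β hβ).emb.injective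
    (a₁ := (⟨x, hx⟩, ⟨c, hc⟩)) (a₂ := (⟨w, hw⟩, ⟨e, he⟩)) h
  simp only [Prod.mk.injEq, Subtype.mk.injEq] at this
  exact ⟨rfl, this⟩

theorem bdry_subset_zero {n : ℕ} {β : Box T} (hβ : β ∈ F.boxes n) :
    β.bdry ⊆ ⋃ γ ∈ F.boxes 0, γ.bdry := by
  induction n generalizing β with
  | zero => exact subset_biUnion_of_mem (u := Box.bdry) hβ
  | succ n ih => exact ((F.zoomedOut n).bdry β hβ).trans (iUnion₂_subset fun γ hγ => ih hγ)

/-- The vertical boundaries lie in those of the boxes of the prototiles, and so avoid the interiors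
of the tiles. -/
theorem notMem_bdry_of_mem_interior (hX : ∀ p ∈ X, IsRect p) {n : ℕ} {β : Box T}
    (hβ : β ∈ F.boxes n) {S : Hull T} {t : Set (E d)} (ht : t ∈ S.tiles) {x : E d}
    (hx : x ∈ interior t) : seen x S ∉ β.bdry := by
  intro h
  have h := bdry_subset_zero hβ h
  simp only [mem_iUnion, exists_prop] at h
  obtain ⟨γ, hγ, w, hw, c, hc, e⟩ := h
  rw [F.zero] at hγ
  obtain ⟨hP, hC, -⟩ := hγ
  rw [hC] at hc
  have hcs : (x - w) +ᵥ γ.P ∈ S.tiles := by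
    rw [← mem_tiles_seen, sub_eq_neg_add, ← seen_seen, e, seen_seen]
    simpa using hc
  have hwP : w ∈ γ.P := (hX _ hP).isClosed.frontier_subset hw
  have hx' : x ∈ (x - w) +ᵥ γ.P := ⟨w, hwP, by simp⟩
  have heq := S.tile_eq hX ht hcs hx hx'
  rw [heq, interior_vadd, mem_vadd_set_iff_neg_vadd_mem] at hx
  rw [(hX _ hP).isClosed.frontier_eq] at hw
  apply hw.2
  simpa using hx

theorem exists_mem_opn (hX : ∀ p ∈ X, IsRect p) (n : ℕ) {S : Hull T} {t : Set (E d)}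
    (ht : t ∈ S.tiles) {x : E d} (hx : x ∈ interior t) :
    ∃ β ∈ F.boxes n, ∃ u, seen u S ∈ β.C ∧ x - u ∈ interior β.P := by
  obtain ⟨β, hβ, w, hw, c, hc, e⟩ := F.exists_mem_cls n (seen x S)
  refine ⟨β, hβ, x - w, ?_, ?_⟩
  · rw [sub_eq_neg_add, ← seen_seen, e, seen_seen]
    simpa using hc
  · rw [sub_sub_cancel]
    by_contra hcon
    refine notMem_bdry_of_mem_interior hX hβ ht hx ⟨w, ?_, c, hc, e⟩
    rw [((F.decomposition n).isBox β hβ).block.isClosed.frontier_eq]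
    exact ⟨hw, hcon⟩

/-- The interior of a tile is connected and avoids the vertical boundaries of every decomposition:
hence the tile is contained in a single tile of every decomposition. -/
theorem exists_box_of_tile (hX : ∀ p ∈ X, IsRect p) (n : ℕ) {S : Hull T} {t : Set (E d)}
    (ht : t ∈ S.tiles) :
    ∃ β ∈ F.boxes n, ∃ u, seen u S ∈ β.C ∧ -u +ᵥ t ⊆ β.P := by
  have hr := S.isRect hX ht
  obtain ⟨x₀, hx₀⟩ := hr.interior_nonempty
  obtain ⟨β, hβ, u, hu, hxu⟩ := exists_mem_opn (F := F) hX n ht hx₀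
  refine ⟨β, hβ, u, hu, ?_⟩
  have hsub : interior t ⊆ u +ᵥ interior β.P := by
    refine hr.convex.interior.isPreconnected.subset_left_of_subset_union
      (v := ⋃ γ ∈ F.boxes n, ⋃ w ∈ {w | seen w S ∈ γ.C ∧ (γ, w) ≠ (β, u)}, w +ᵥ interior γ.P)
      (isOpen_interior.vadd u) ?_ ?_ ?_ ⟨x₀, hx₀, ?_⟩
    · exact isOpen_biUnion fun γ _ => isOpen_biUnion fun w _ => isOpen_interior.vadd w
    · simp only [disjoint_iUnion_right]
      rintro γ hγ w ⟨hw, hne⟩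
      refine disjoint_left.2 fun z hz hz' => hne ?_
      rw [mem_vadd_set_iff_neg_vadd_mem, vadd_eq_add, neg_add_eq_sub] at hz hz'
      obtain ⟨h1, h2, -⟩ := box_unique hβ hγ hz hz' hu hw (by
        rw [seen_seen, seen_seen, sub_add_cancel, sub_add_cancel])
      rw [h1, sub_right_injective h2]
    · intro x hx
      obtain ⟨γ, hγ, w, hw, hxw⟩ := exists_mem_opn (F := F) hX n ht hx
      have hx' : x ∈ w +ᵥ interior γ.P := by
        rwa [mem_vadd_set_iff_neg_vadd_mem, vadd_eq_add, neg_add_eq_sub]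
      by_cases h : (γ, w) = (β, u)
      · left
        obtain ⟨rfl, rfl⟩ := Prod.mk.inj h
        exact hx'
      · right
        simp only [mem_iUnion]
        exact ⟨γ, hγ, w, ⟨hw, h⟩, hx'⟩
    · rwa [mem_vadd_set_iff_neg_vadd_mem, vadd_eq_add, neg_add_eq_sub]
  have hcl : IsClosed (u +ᵥ β.P) := ((F.decomposition n).isBox β hβ).block.isClosed.vadd u
  have : t ⊆ u +ᵥ β.P := by
    rw [← hr.closure_interior]
    exact closure_minimal (hsub.trans (vadd_set_mono interior_subset)) hcl
  rintro _ ⟨x, hx, rfl⟩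
  exact mem_vadd_set_iff_neg_vadd_mem.1 (this hx)

theorem SameVertical.symm {n : ℕ} {S S' : Hull T} (h : F.SameVertical n S S') :
    F.SameVertical n S' S := by
  obtain ⟨β, hβ, x, hx, c, hc, c', hc', h, h'⟩ := h
  exact ⟨β, hβ, x, hx, c', hc', c, hc, h', h⟩

/-- Tilings on a common vertical share the tile which has the origin in its interior. -/
theorem SameVertical.mem_tiles (hX : ∀ p ∈ X, IsRect p) {n : ℕ} {S S' : Hull T}
    (h : F.SameVertical n S S') {t : Set (E d)} (ht : t ∈ S.tiles) (h0 : 0 ∈ interior t) :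
    t ∈ S'.tiles := by
  obtain ⟨β, hβ, x, hx, c, hc, c', hc', rfl, rfl⟩ := F.sameVertical_le (Nat.zero_le n) h
  rw [F.zero] at hβ
  obtain ⟨hP, hC, -⟩ := hβ
  rw [hC] at hc hc'
  rw [mem_tiles_seen] at ht ⊢
  have hx' : x ∈ interior (x +ᵥ t) := by
    rw [interior_vadd]
    exact ⟨0, h0, by simp⟩
  rwa [c.tile_eq hX ht hc hx' hx]

/-- Two tilings on a common vertical remain so along their common tile around the origin, since
this tile lies in a single tile of the decomposition. -/
theorem SameVertical.seen (hX : ∀ p ∈ X, IsRect p) {n : ℕ} {S S' : Hull T}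
    (h : F.SameVertical n S S') {t : Set (E d)} (ht : t ∈ S.tiles) (h0 : 0 ∈ interior t)
    {x : E d} (hx : x ∈ t) : F.SameVertical n (seen x S) (seen x S') := by
  obtain ⟨γ, hγ, u, hu, htu⟩ := exists_box_of_tile (F := F) hX n ht
  have h0u : -u ∈ interior γ.P := by
    have : -u ∈ interior (-u +ᵥ t) := by
      rw [interior_vadd]
      exact ⟨0, h0, by simp⟩
    exact interior_mono htu this
  obtain ⟨β, hβ, w, hw, c, hc, c', hc', e, e'⟩ := h
  have hwi : w ∈ interior β.P := by
    by_contra hcon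
    refine notMem_bdry_of_mem_interior hX hβ ht h0 ⟨w, ?_, c, hc, by simpa using e⟩
    rw [((F.decomposition n).isBox β hβ).block.isClosed.frontier_eq]
    exact ⟨hw, hcon⟩
  obtain ⟨rfl, rfl, -⟩ := box_unique hγ hβ h0u hwi hu hc (by rw [seen_seen]; simpa using e)
  refine ⟨γ, hβ, x - u, ?_, c, hc, c', hc', ?_, ?_⟩
  · exact htu ⟨x, hx, by simp [sub_eq_neg_add]⟩
  · rw [e, seen_seen, sub_eq_add_neg]
  · rw [e', seen_seen, sub_eq_add_neg]

/-- By border forcing, two tilings whose points `z` lie on a common vertical of the decomposition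
`n + 1` have their points in any tile containing `z` on common verticals of the decomposition
`n`. -/
theorem SameVertical.seen_of_succ (hX : ∀ p ∈ X, IsRect p) {n : ℕ} {S S' : Hull T} {z : E d}
    (h : F.SameVertical (n + 1) (TilingHull.seen z S) (TilingHull.seen z S')) {t : Set (E d)}
    (ht : t ∈ S.tiles) (hz : z ∈ t)
    {x : E d} (hx : x ∈ t) :
    F.SameVertical n (TilingHull.seen x S) (TilingHull.seen x S') := by
  obtain ⟨β, hβ, u, hu, htu⟩ := exists_box_of_tile (F := F) hX n ht
  obtain ⟨γ, hγ, w, hw, c, hc, c', hc', e, e'⟩ := h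
  -- `w - (z - u)` is the position, in the box of `c`, of the tile of type `β`
  have key : ∀ R e : Hull T, TilingHull.seen z R = TilingHull.seen w e →
      TilingHull.seen (w - (z - u)) e = TilingHull.seen u R := by
    intro R e h
    rw [show w - (z - u) = -(z - u) + w by abel, ← seen_seen, ← h, seen_seen]
    congr 1; abel
  have hP : ∀ x ∈ t, x - u ∈ β.P := fun x hx => htu ⟨x, hx, by simp [sub_eq_neg_add]⟩
  have hu' := F.forcesBorder n γ hγ c hc c' hc' w hw β hβ (z - u) (hP z hz)
    (by rw [key S c e]; exact hu)
  rw [key S' c' e'] at hu'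
  exact ⟨β, hβ, x - u, hP x hx, _, hu, _, hu', by rw [seen_seen, sub_add_cancel],
    by rw [seen_seen, sub_add_cancel]⟩

/-- The decompositions separate the points of the hull: if `S` and `S'` lie on a common vertical
of every decomposition, then by border forcing the set of the `z` for which this holds for `S - z`
and `S' - z` is a union of tiles of `S`, as well as its complement, and it is everything by
connectedness. -/
theorem eq_of_forall_sameVertical (hXfin : X.Finite) (hX : ∀ p ∈ X, IsRect p) {S S' : Hull T}
    (h : ∀ n, F.SameVertical n S S') : S = S' := by
  set G : Set (E d) := {z | ∀ n, F.SameVertical n (TilingHull.seen z S) (TilingHull.seen z S')}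
  have hG : ∀ z ∈ G, ∀ t ∈ S.tiles, z ∈ t → t ⊆ G := fun z hz t ht hzt x hx n =>
    (hz (n + 1)).seen_of_succ hX ht hzt hx
  have hclosed : ∀ A : Set (E d), (∀ z ∈ A, ∀ t ∈ S.tiles, z ∈ t → t ⊆ A) → IsClosed A := by
    intro A hA
    have : A = ⋃₀ {t ∈ S.tiles | t ⊆ A} := by
      refine Subset.antisymm (fun z hz => ?_) (sUnion_subset fun t ht => ht.2)
      obtain ⟨t, ht, hzt⟩ := S.exists_tile z
      exact ⟨t, ⟨ht, hA z hz t ht hzt⟩, hzt⟩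
    rw [this]
    exact S.1.isClosed_sUnion_tiles hXfin hX fun t ht => ht.1
  have hGc : IsClopen G := by
    refine ⟨hclosed G hG, ?_⟩
    rw [← isClosed_compl_iff]
    refine hclosed _ fun z hz t ht hzt x hx hxG => hz (hG x hxG t ht hx hzt)
  have huniv : G = univ := hGc.eq_univ ⟨0, fun n => by simpa using h n⟩
  have hsub : S.tiles ⊆ S'.tiles := by
    intro t ht
    obtain ⟨z, hz⟩ := (S.isRect hX ht).interior_nonempty
    have hzG : z ∈ G := huniv ▸ trivial
    have := (hzG 0).mem_tiles hX (t := -z +ᵥ t) (by rw [mem_tiles_seen]; simpa using ht)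
      (by rw [interior_vadd]; exact ⟨z, hz, by simp⟩)
    rw [mem_tiles_seen] at this
    simpa using this
  refine Hull.ext_tiles (Subset.antisymm hsub fun t ht => ?_)
  obtain ⟨z, hz⟩ := (S'.isRect hX ht).interior_nonempty
  obtain ⟨s, hs, hzs⟩ := S.exists_tile z
  rwa [S'.tile_eq hX ht (hsub hs) hz hzs]

/-! ### Compactness and continuity -/

theorem compactSpace (F : BoxSequence T) : CompactSpace (Hull T) := by
  refine ⟨?_⟩
  rw [← (F.decomposition 0).cover]
  refine (F.decomposition 0).finite.isCompact_biUnion fun β hβ => ?_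
  have hb := (F.decomposition 0).isBox β hβ
  have : β.cls = (fun q : E d × Hull T => TilingHull.seen q.1 q.2) '' (β.P ×ˢ β.C) := by
    ext S
    constructor
    · rintro ⟨x, hx, c, hc, rfl⟩
      exact ⟨(x, c), ⟨hx, hc⟩, rfl⟩
    · rintro ⟨⟨x, c⟩, ⟨hx, hc⟩, rfl⟩
      exact ⟨x, hx, c, hc, rfl⟩
  rw [this]
  exact (hb.block.isCompact.prod hb.compact).image continuous_seen

/-- Functions on `B_n` which are continuous along the leaves are continuous on the hull, since
the hull carries the quotient topology of the disjoint union of the closed boxes `P × C`, on which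
they depend on the coordinate in `P` only. -/
theorem continuous_of_leafwise (hX : ∀ p ∈ X, IsRect p) {n : ℕ} {G : Type*} [TopologicalSpace G]
    (g : F.Branched n → G) (hg : ∀ S : Hull T, Continuous fun x : E d => g (F.proj n (seen x S))) :
    Continuous fun S => g (F.proj n S) := by
  have := Hull.t2Space (T := T) hX
  rw [continuous_iff_isClosed]
  intro A hA
  have : (fun S => g (F.proj n S)) ⁻¹' A = ⋃ β ∈ F.boxes n,
      (fun q : E d × Hull T => TilingHull.seen q.1 q.2) ''
        ({x ∈ β.P | ∃ c ∈ β.C, g (F.proj n (seen x c)) ∈ A} ×ˢ β.C) := by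
    ext S
    simp only [mem_preimage, mem_iUnion, exists_prop]
    constructor
    · intro hS
      obtain ⟨β, hβ, x, hx, c, hc, rfl⟩ := F.exists_mem_cls n S
      exact ⟨β, hβ, (x, c), ⟨⟨hx, c, hc, hS⟩, hc⟩, rfl⟩
    · rintro ⟨β, hβ, ⟨x, c⟩, ⟨⟨hx, c', hc', h⟩, hc⟩, rfl⟩
      have : F.proj n (TilingHull.seen x c) = F.proj n (TilingHull.seen x c') :=
        Quot.sound ⟨β, hβ, x, hx, c, hc, c', hc', rfl, rfl⟩
      rwa [this]
  rw [this]
  refine (F.decomposition n).finite.isClosed_biUnion fun β hβ => IsCompact.isClosed ?_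
  have hb := (F.decomposition n).isBox β hβ
  refine (IsCompact.prod ?_ hb.compact).image continuous_seen
  obtain ⟨c, hc⟩ := hb.nonempty
  have : {x ∈ β.P | ∃ c ∈ β.C, g (F.proj n (TilingHull.seen x c)) ∈ A} =
      β.P ∩ (fun x => g (F.proj n (TilingHull.seen x c))) ⁻¹' A := by
    ext x
    refine and_congr_right fun hx => ⟨?_, fun h => ⟨c, hc, h⟩⟩
    rintro ⟨c', hc', h⟩
    have : F.proj n (TilingHull.seen x c) = F.proj n (TilingHull.seen x c') :=
      Quot.sound ⟨β, hβ, x, hx, c, hc, c', hc', rfl, rfl⟩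
    rwa [mem_preimage, this]
  rw [this]
  exact hb.block.isCompact.inter_right (hA.preimage (hg c))

theorem isClosed_sameVertical (hX : ∀ p ∈ X, IsRect p) (n : ℕ) :
    IsClosed {q : Hull T × Hull T | F.SameVertical n q.1 q.2} := by
  have := Hull.t2Space (T := T) hX
  have : {q : Hull T × Hull T | F.SameVertical n q.1 q.2} = ⋃ β ∈ F.boxes n,
      (fun q : E d × Hull T × Hull T =>
        (TilingHull.seen q.1 q.2.1, TilingHull.seen q.1 q.2.2)) '' (β.P ×ˢ (β.C ×ˢ β.C)) := by
    ext ⟨S, S'⟩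
    simp only [mem_iUnion, exists_prop]
    constructor
    · rintro ⟨β, hβ, x, hx, c, hc, c', hc', h, h'⟩
      exact ⟨β, hβ, (x, c, c'), ⟨hx, hc, hc'⟩, Prod.ext h.symm h'.symm⟩
    · rintro ⟨β, hβ, ⟨x, c, c'⟩, ⟨hx, hc, hc'⟩, h⟩
      exact ⟨β, hβ, x, hx, c, hc, c', hc', (Prod.mk.inj h).1.symm, (Prod.mk.inj h).2.symm⟩
  rw [this]
  refine (F.decomposition n).finite.isClosed_biUnion fun β hβ => IsCompact.isClosed ?_
  have hb := (F.decomposition n).isBox β hβ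
  refine (hb.block.isCompact.prod (hb.compact.prod hb.compact)).image ?_
  exact (continuous_seen.comp (continuous_fst.prodMk continuous_snd.fst)).prodMk
    (continuous_seen.comp (continuous_fst.prodMk continuous_snd.snd))

end BoxSequence

/-! ### Disintegration of invariant measures -/

theorem mem_vadd_set_iff_sub_mem {v x : E d} {A : Set (E d)} : x ∈ v +ᵥ A ↔ x - v ∈ A := by
  rw [mem_vadd_set_iff_neg_vadd_mem, vadd_eq_add, neg_add_eq_sub]

/-- A measure on an open set `V` which is invariant under the translations that remain in `V` is
proportional to Lebesgue measure on `V`; both sides are the integral over `v` of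
`m (A ∩ (V + v)) = m ((A - v) ∩ V)`. -/
theorem measure_mul_volume_of_locally_invariant {m : Measure (E d)} [SFinite m] {V A : Set (E d)}
    (hV : MeasurableSet V) (hA : MeasurableSet A) (hAV : A ⊆ V)
    (hm : ∀ (v : E d) (B : Set (E d)), MeasurableSet B → B ⊆ V → v +ᵥ B ⊆ V → m (v +ᵥ B) = m B) :
    m A * volume V = m V * volume A := by
  have h1 : ∀ v : E d, m (A ∩ (v +ᵥ V)) = ∫⁻ a in A, V.indicator 1 (a - v) ∂m := by
    intro v
    have : ∀ a, V.indicator (1 : E d → ENNReal) (a - v) = (v +ᵥ V).indicator 1 a := by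
      intro a
      by_cases h : a - v ∈ V
      · rw [indicator_of_mem h, indicator_of_mem (mem_vadd_set_iff_sub_mem.2 h)]; rfl
      · rw [indicator_of_notMem h, indicator_of_notMem (mt mem_vadd_set_iff_sub_mem.1 h)]
    simp only [this]
    rw [lintegral_indicator_one (hV.const_vadd v), Measure.restrict_apply (hV.const_vadd v),
      inter_comm]
  have h2 : ∀ v : E d, m (A ∩ (v +ᵥ V)) = ∫⁻ w in V, A.indicator 1 (w + v) ∂m := by
    intro v
    have : ∀ a, A.indicator (1 : E d → ENNReal) (a + v) = (-v +ᵥ A).indicator 1 a := by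
      intro a
      have hiff : a ∈ -v +ᵥ A ↔ a + v ∈ A := by rw [mem_vadd_set_iff_sub_mem, sub_neg_eq_add]
      by_cases h : a + v ∈ A
      · rw [indicator_of_mem h, indicator_of_mem (hiff.2 h)]; rfl
      · rw [indicator_of_notMem h, indicator_of_notMem (mt hiff.1 h)]
    simp only [this]
    rw [lintegral_indicator_one (hA.const_vadd _), Measure.restrict_apply (hA.const_vadd _)]
    have he : v +ᵥ ((-v +ᵥ A) ∩ V) = A ∩ (v +ᵥ V) := by
      rw [vadd_set_inter, vadd_neg_vadd]
    rw [← he]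
    refine hm v _ ((hA.const_vadd _).inter hV) inter_subset_right ?_
    rw [he]
    exact inter_subset_left.trans hAV
  have e1 : (∫⁻ v : E d, m (A ∩ (v +ᵥ V))) = m A * volume V := by
    simp only [h1]
    rw [lintegral_lintegral_swap]
    · simp only [lintegral_sub_left_eq_self (V.indicator (1 : E d → ENNReal)),
        lintegral_indicator_one hV, lintegral_const, Measure.restrict_apply_univ]
      rw [mul_comm]
    · refine Measurable.aemeasurable ?_
      exact (measurable_one.indicator hV).comp (measurable_snd.sub measurable_fst)
  have e2 : (∫⁻ v : E d, m (A ∩ (v +ᵥ V))) = m V * volume A := by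
    simp only [h2]
    rw [lintegral_lintegral_swap]
    · simp only [lintegral_add_left_eq_self (A.indicator (1 : E d → ENNReal)),
        lintegral_indicator_one hA, lintegral_const, Measure.restrict_apply_univ]
      rw [mul_comm]
    · refine Measurable.aemeasurable ?_
      exact (measurable_one.indicator hA).comp (measurable_snd.add measurable_fst)
  rw [← e1, e2]

theorem measure_image_seen (μ : Measure (Hull T)) [VAddInvariantMeasure (E d) (Hull T) μ] (v : E d)
    (W : Set (Hull T)) : μ (seen v '' W) = μ W := by
  have : seen v '' W = (fun S : Hull T => v +ᵥ S) ⁻¹' W := by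
    ext S
    constructor
    · rintro ⟨R, hR, rfl⟩
      simpa [seen] using hR
    · intro h
      exact ⟨_, h, by simp [seen]⟩
  have hc : MeasurableConstVAdd (E d) (Hull T) :=
    ⟨fun v => ((continuous_seen_right (T := T) (-v)).congr fun S => by simp [seen]).measurable⟩
  rw [this, measure_preimage_vadd]

theorem measurePreserving_seen (μ : Measure (Hull T)) [VAddInvariantMeasure (E d) (Hull T) μ]
    (v : E d) : MeasurePreserving (seen v) μ μ := by
  refine ⟨(continuous_seen_right v).measurable, Measure.ext fun W hW => ?_⟩
  rw [Measure.map_apply (continuous_seen_right v).measurable hW, ← measure_image_seen μ v,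
    image_preimage_eq]
  intro S
  exact ⟨seen (-v) S, by rw [seen_seen, add_neg_cancel, seen_zero]⟩

namespace Chart

variable (K : Chart T)

/-- The inverse `(x, c) ↦ c - x` of the coordinates of a chart. -/
def map (q : K.V × K.C) : Hull T := seen (q.1 : E d) (q.2 : Hull T)

theorem measurableEmbedding_map : MeasurableEmbedding K.map :=
  K.emb.measurableEmbedding

theorem range_map : range K.map = K.domain := by
  ext S
  constructor
  · rintro ⟨⟨x, c⟩, rfl⟩
    exact ⟨x, x.2, c, c.2, rfl⟩
  · rintro ⟨x, hx, c, hc, rfl⟩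
    exact ⟨(⟨x, hx⟩, ⟨c, hc⟩), rfl⟩

theorem isOpen_domain : IsOpen K.domain := by
  rw [← range_map]
  exact K.emb.isOpen_range

theorem volume_ne_zero : volume K.V ≠ 0 := (K.isOpen.measure_pos volume K.nonempty).ne'

theorem volume_ne_top : volume K.V ≠ ⊤ := K.bounded.measure_lt_top.ne

variable (μ : Measure (Hull T))

instance isFiniteMeasure_comap [IsFiniteMeasure μ] : IsFiniteMeasure (μ.comap K.map) := by
  refine ⟨?_⟩
  rw [K.measurableEmbedding_map.comap_apply]
  exact measure_lt_top μ _

instance isFiniteMeasure_transverse [IsFiniteMeasure μ] : IsFiniteMeasure (transverse μ K.V K.C) := by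
  refine ⟨?_⟩
  change ((volume K.V)⁻¹ • (μ.comap K.map).map Prod.snd) univ < ⊤
  rw [Measure.smul_apply, smul_eq_mul]
  exact ENNReal.mul_lt_top (ENNReal.inv_lt_top.2 (pos_iff_ne_zero.2 K.volume_ne_zero))
    (measure_lt_top _ _)

theorem transverse_apply {B : Set K.C} (hB : MeasurableSet B) :
    transverse μ K.V K.C B = (volume K.V)⁻¹ * μ.comap K.map (univ ×ˢ B) := by
  change ((volume K.V)⁻¹ • (μ.comap K.map).map Prod.snd) B = _
  rw [Measure.smul_apply, smul_eq_mul, Measure.map_apply measurable_snd hB, univ_prod]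

variable [IsFiniteMeasure μ] [VAddInvariantMeasure (E d) (Hull T) μ]

/-- In a chart, an invariant measure is the product of Lebesgue measure and its transverse
measure. -/
theorem comap_map_eq_prod :
    μ.comap K.map = (Measure.comap Subtype.val volume : Measure K.V).prod
      (transverse μ K.V K.C) := by
  have hVm := K.isOpen.measurableSet
  have hfin : IsFiniteMeasure (Measure.comap Subtype.val volume : Measure K.V) := by
    refine ⟨?_⟩
    rw [comap_subtype_coe_apply hVm, image_univ, Subtype.range_coe]
    exact K.bounded.measure_lt_top
  symm
  refine Measure.prod_eq fun s B hs hB => ?_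
  set m : Measure (E d) := ((μ.comap K.map).restrict (univ ×ˢ B)).map fun q => (q.1 : E d)
    with hm_def
  have hmeas : Measurable fun q : K.V × K.C => (q.1 : E d) :=
    measurable_subtype_coe.comp measurable_fst
  have hm : ∀ A, MeasurableSet A → m A = μ (K.map '' ((Subtype.val ⁻¹' A) ×ˢ B)) := by
    intro A hA
    rw [hm_def, Measure.map_apply hmeas hA, Measure.restrict_apply (hmeas hA),
      K.measurableEmbedding_map.comap_apply]
    congr 2
    ext ⟨x, c⟩
    simp
  have hinv : ∀ (v : E d) (A : Set (E d)), MeasurableSet A → A ⊆ K.V → v +ᵥ A ⊆ K.V →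
      m (v +ᵥ A) = m A := by
    intro v A hA hAV hvA
    rw [hm _ (hA.const_vadd v), hm _ hA,
      ← measure_image_seen μ v (K.map '' (Subtype.val ⁻¹' A) ×ˢ B)]
    congr 1
    ext S
    constructor
    · rintro ⟨⟨x, c⟩, ⟨hx, hc⟩, rfl⟩
      obtain ⟨a, ha, hax⟩ : x.1 ∈ v +ᵥ A := hx
      refine ⟨_, ⟨(⟨a, hAV ha⟩, c), ⟨ha, hc⟩, rfl⟩, ?_⟩
      simp only [map, seen_seen]
      rw [← hax]; rfl
    · rintro ⟨_, ⟨⟨x, c⟩, ⟨hx, hc⟩, rfl⟩, rfl⟩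
      have hx' : v + (x : E d) ∈ v +ᵥ A := ⟨x, hx, rfl⟩
      refine ⟨(⟨v + x, hvA hx'⟩, c), ⟨hx', hc⟩, ?_⟩
      simp only [map, seen_seen]
  have hAm : MeasurableSet (Subtype.val '' s) := hVm.subtype_image hs
  have key := measure_mul_volume_of_locally_invariant hVm hAm (Subtype.coe_image_subset _ _) hinv
  rw [hm _ hAm, hm _ hVm, preimage_image_eq _ Subtype.val_injective, Subtype.coe_preimage_self,
    ← K.measurableEmbedding_map.comap_apply, ← K.measurableEmbedding_map.comap_apply] at key
  rw [comap_subtype_coe_apply hVm, transverse_apply _ _ hB, mul_left_comm, mul_comm (volume _),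
    ← key, mul_comm (μ.comap _ _), ← mul_assoc,
    ENNReal.inv_mul_cancel K.volume_ne_zero K.volume_ne_top, one_mul]

/-- Integration over the domain of a chart. -/
theorem setIntegral_domain {g : Hull T → ℝ} (hg : IntegrableOn g K.domain μ) :
    ∫ S in K.domain, g S ∂μ =
      ∫ c : K.C, (∫ x in K.V, g (seen x c)) ∂(transverse μ K.V K.C) := by
  have hVm := K.isOpen.measurableSet
  have hfin : IsFiniteMeasure (Measure.comap Subtype.val volume : Measure K.V) := by
    refine ⟨?_⟩
    rw [comap_subtype_coe_apply hVm, image_univ, Subtype.range_coe]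
    exact K.bounded.measure_lt_top
  rw [IntegrableOn, ← range_map, ← K.measurableEmbedding_map.map_comap,
    K.measurableEmbedding_map.integrable_map_iff, comap_map_eq_prod] at hg
  rw [← range_map, ← K.measurableEmbedding_map.map_comap, K.measurableEmbedding_map.integral_map,
    comap_map_eq_prod]
  refine (integral_prod_symm _ hg).trans ?_
  refine integral_congr_ae (Filter.Eventually.of_forall fun c => ?_)
  exact integral_subtype_comap hVm fun x => g (seen x c)

end Chart

/-- By disintegration in the charts, the Ruelle–Sullivan current is integration on the hull. -/
theorem ruelleSullivan_eq_integral [CompactSpace (Hull T)] {ι : Type*} [Fintype ι]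
    (K : ι → Chart T) (ρ : PartitionOfUnity ι (Hull T))
    (hρ : ρ.IsSubordinate fun i => (K i).domain)
    (μ : Measure (Hull T)) [IsFiniteMeasure μ] [VAddInvariantMeasure (E d) (Hull T) μ]
    {ω : Hull T → E d [⋀^Fin d]→L[ℝ] ℝ} (hω : Continuous fun S => coeff (ω S)) :
    ruelleSullivan K ρ μ ω = ∫ S, coeff (ω S) ∂μ := by
  have hint : ∀ i, Integrable (fun S => ρ i S * coeff (ω S)) μ := fun i =>
    ((ρ i).continuous.mul hω).integrable_of_hasCompactSupport (HasCompactSupport.of_compactSpace _)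
  have h1 : ∀ i, ∫ c : (K i).C, (∫ x in (K i).V, ρ i (seen x c) * coeff (ω (seen x c)))
      ∂(transverse μ (K i).V (K i).C) = ∫ S, ρ i S * coeff (ω S) ∂μ := by
    intro i
    rw [← (K i).setIntegral_domain μ (g := fun S => ρ i S * coeff (ω S)) (hint i).integrableOn]
    refine setIntegral_eq_integral_of_forall_compl_eq_zero fun S hS => ?_
    rw [image_eq_zero_of_notMem_tsupport fun h => hS (hρ i h), zero_mul]
  rw [ruelleSullivan, Finset.sum_congr rfl fun i _ => h1 i, ← integral_finsetSum _ fun i _ => hint i]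
  refine integral_congr_ae (Filter.Eventually.of_forall fun S => ?_)
  change ∑ i, ρ i S * coeff (ω S) = coeff (ω S)
  rw [← Finset.sum_mul, ← finsum_eq_sum_of_fintype, ρ.sum_eq_one (mem_univ S), one_mul]

/-! ### Integrals of exact forms -/

theorem integral_comp_seen (μ : Measure (Hull T)) [VAddInvariantMeasure (E d) (Hull T) μ]
    {g : Hull T → ℝ} (hg : Continuous g) (v : E d) :
    ∫ S, g (seen v S) ∂μ = ∫ S, g S ∂μ := by
  conv_rhs => rw [← (measurePreserving_seen μ v).map_eq]
  exact (integral_map (continuous_seen_right v).measurable.aemeasurable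
    hg.aestronglyMeasurable).symm

namespace BoxSequence

variable {F : BoxSequence T}

/-- The derivative along the leaves of a function on `B_n` is constant on the verticals, hence it is
again a function on `B_n`. -/
theorem fderiv_eq_of_sameVertical {n : ℕ} {h : F.Branched n → ℝ}
    (hh : ∀ S : Hull T, ContDiff ℝ 1 fun x : E d => h (F.proj n (seen x S)))
    {S S' : Hull T} (hS : F.SameVertical n S S') :
    fderiv ℝ (fun x : E d => h (F.proj n (seen x S))) 0 =
      fderiv ℝ (fun x : E d => h (F.proj n (seen x S'))) 0 := by
  obtain ⟨β, hβ, w, hw, c, hc, c', hc', rfl, rfl⟩ := hS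
  simp only [seen_seen]
  rw [fderiv_comp_add_right (f := fun x : E d => h (F.proj n (seen x c))),
    fderiv_comp_add_right (f := fun x : E d => h (F.proj n (seen x c'))), zero_add]
  -- both derivatives are continuous and they agree on the interior of the block, which is dense
  have hcl : IsClosed {x | fderiv ℝ (fun x : E d => h (F.proj n (seen x c))) x =
      fderiv ℝ (fun x : E d => h (F.proj n (seen x c'))) x} :=
    isClosed_eq ((hh c).continuous_fderiv one_ne_zero) ((hh c').continuous_fderiv one_ne_zero)
  refine closure_minimal (fun x hx => ?_) hcl
    (((F.decomposition n).isBox β hβ).block.subset_closure_interior hw)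
  refine Filter.EventuallyEq.fderiv_eq ?_
  filter_upwards [isOpen_interior.mem_nhds hx] with z hz
  exact congrArg h (Quot.sound ⟨β, hβ, z, interior_subset hz, c, hc, c', hc', rfl, rfl⟩)

theorem continuous_fderiv_leaf (hX : ∀ p ∈ X, IsRect p) {n : ℕ} {h : F.Branched n → ℝ}
    (hh : ∀ S : Hull T, ContDiff ℝ 1 fun x : E d => h (F.proj n (seen x S))) :
    Continuous fun S : Hull T => fderiv ℝ (fun x : E d => h (F.proj n (seen x S))) 0 := by
  refine continuous_of_leafwise (F := F) (n := n) hX (Quot.lift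
    (fun S : Hull T => fderiv ℝ (fun x : E d => h (F.proj n (seen x S))) 0)
    fun S S' hS => fderiv_eq_of_sameVertical hh hS) fun S => ?_
  refine ((hh S).continuous_fderiv one_ne_zero).congr fun y => ?_
  change _ = fderiv ℝ (fun x : E d => h (F.proj n (seen x (seen y S)))) 0
  simp only [seen_seen]
  rw [fderiv_comp_add_right (f := fun x : E d => h (F.proj n (seen x S))), zero_add]

/-- Derivatives along the leaves have integral zero for an invariant measure: the integral of
`h (S - v) - h S` vanishes, and it is also the integral over `[0, 1]` of the integrals of the
derivative of `h` at `S - t v`, which are all equal. -/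
theorem integral_fderiv_leaf (hX : ∀ p ∈ X, IsRect p) (μ : Measure (Hull T)) [IsFiniteMeasure μ]
    [VAddInvariantMeasure (E d) (Hull T) μ] {n : ℕ} {h : F.Branched n → ℝ}
    (hh : ∀ S : Hull T, ContDiff ℝ 1 fun x : E d => h (F.proj n (seen x S))) (v : E d) :
    ∫ S : Hull T, fderiv ℝ (fun x : E d => h (F.proj n (seen x S))) 0 v ∂μ = 0 := by
  have := F.compactSpace
  set D : Hull T → ℝ := fun S => fderiv ℝ (fun x : E d => h (F.proj n (seen x S))) 0 v with hD
  have hDc : Continuous D := (continuous_fderiv_leaf hX hh).clm_apply continuous_const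
  have hhc : Continuous fun S => h (F.proj n S) :=
    continuous_of_leafwise hX h fun S => (hh S).continuous
  have hint : ∀ {g : Hull T → ℝ}, Continuous g → Integrable g μ := fun hg =>
    hg.integrable_of_hasCompactSupport (HasCompactSupport.of_compactSpace _)
  have hFTC : ∀ S, h (F.proj n (seen v S)) - h (F.proj n S) =
      ∫ t in (0 : ℝ)..1, D (seen (t • v) S) := by
    intro S
    have hd : ∀ t ∈ uIcc (0 : ℝ) 1, HasDerivAt (fun t : ℝ => h (F.proj n (seen (t • v) S)))
        (D (seen (t • v) S)) t := by
      intro t _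
      have h1 : HasFDerivAt (fun x : E d => h (F.proj n (seen x S)))
          (fderiv ℝ (fun x : E d => h (F.proj n (seen x S))) (t • v)) (t • v) :=
        ((hh S).differentiable one_ne_zero _).hasFDerivAt
      have h2 : HasDerivAt (fun t : ℝ => t • v) v t := by
        simpa using (hasDerivAt_id t).smul_const v
      have h3 := h1.comp_hasDerivAt t h2
      have h4 : D (seen (t • v) S) =
          fderiv ℝ (fun x : E d => h (F.proj n (seen x S))) (t • v) v := by
        simp only [hD, seen_seen]
        rw [fderiv_comp_add_right (f := fun x : E d => h (F.proj n (seen x S))), zero_add]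
      rw [h4]
      exact h3
    rw [intervalIntegral.integral_eq_sub_of_hasDerivAt hd]
    · simp
    · refine Continuous.intervalIntegrable ?_ _ _
      exact hDc.comp (continuous_seen.comp (by fun_prop : Continuous fun t : ℝ => (t • v, S)))
  have hz : ∫ S, (h (F.proj n (seen v S)) - h (F.proj n S)) ∂μ = 0 := by
    rw [integral_sub, integral_comp_seen μ hhc, sub_self]
    · exact hint (hhc.comp (continuous_seen_right v))
    · exact hint hhc
  obtain ⟨C, hC⟩ : ∃ C, ∀ S, ‖D S‖ ≤ C := by
    obtain ⟨C, hC⟩ := (isCompact_range hDc).isBounded.exists_norm_le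
    exact ⟨C, fun S => hC _ ⟨S, rfl⟩⟩
  simp only [hFTC, intervalIntegral.integral_of_le zero_le_one] at hz
  rw [integral_integral_swap] at hz
  · simpa [integral_comp_seen μ hDc] using hz
  · refine Integrable.of_bound (Continuous.aestronglyMeasurable ?_) C
      (Filter.Eventually.of_forall fun q => hC _)
    exact hDc.comp (continuous_seen.comp
      (by fun_prop : Continuous fun q : Hull T × ℝ => (q.2 • v, q.1)))

theorem continuous_coeff : Continuous (coeff (d := d)) :=
  continuous_eval_const fun i => EuclideanSpace.single i 1

theorem continuous_coeff_forms (hX : ∀ p ∈ X, IsRect p) {n : ℕ} {ω : F.Field n d}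
    (hω : ω ∈ F.forms n d) : Continuous fun S => coeff (ω (F.proj n S)) :=
  continuous_of_leafwise hX (fun b => coeff (ω b)) fun S => continuous_coeff.comp (hω S).continuous

/-- The coefficient of an exact form is a signed sum of derivatives along the leaves. -/
theorem integral_exactForms (hX : ∀ p ∈ X, IsRect p) (μ : Measure (Hull T)) [IsFiniteMeasure μ]
    [VAddInvariantMeasure (E d) (Hull T) μ] {n : ℕ} {ω : F.Field n d}
    (hω : ω ∈ F.exactForms n d) : ∫ S, coeff (ω (F.proj n S)) ∂μ = 0 := by
  have := F.compactSpace
  cases d with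
  | zero =>
    have : ω = 0 := hω
    subst this
    exact integral_zero _ _
  | succ k =>
    obtain ⟨η, hη, e⟩ := hω
    set b : Fin (k + 1) → E (k + 1) := fun i => EuclideanSpace.single i 1
    have hh : ∀ (i : Fin (k + 1)) (S : Hull T),
        ContDiff ℝ 1 fun x : E (k + 1) => η (F.proj n (seen x S)) (i.removeNth b) := by
      intro i S
      have := (ContinuousAlternatingMap.apply ℝ (E (k + 1)) ℝ (i.removeNth b)).contDiff.comp (hη S)
      exact this.of_le (by simp)
    set D : Fin (k + 1) → Hull T → ℝ := fun i S =>
      fderiv ℝ (fun x : E (k + 1) => η (F.proj n (seen x S)) (i.removeNth b)) 0 (b i)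
    have hDc : ∀ i, Continuous (D i) := fun i =>
      (continuous_fderiv_leaf hX (h := fun c => η c (i.removeNth b)) (hh i)).clm_apply
        continuous_const
    have hval : ∀ S, coeff (ω (F.proj n S)) = ∑ i : Fin (k + 1), (-1) ^ i.val * D i S := by
      intro S
      have := e S 0
      rw [along, seen_zero] at this
      rw [this]
      refine (extDeriv_apply (F.forms_differentiable hη S 0) b).trans ?_
      refine Finset.sum_congr rfl fun i _ => ?_
      simp only [D, zsmul_eq_mul, Int.cast_pow, Int.cast_neg, Int.cast_one]
      rfl
    simp only [hval]
    rw [integral_finsetSum]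
    · refine Finset.sum_eq_zero fun i _ => ?_
      rw [integral_const_mul]
      have : ∫ S, D i S ∂μ = 0 :=
        integral_fderiv_leaf hX μ (h := fun c => η c (i.removeNth b)) (hh i) (b i)
      rw [this, mul_zero]
    · intro i _
      exact ((hDc i).const_mul _).integrable_of_hasCompactSupport
        (HasCompactSupport.of_compactSpace _)

end BoxSequence

/-! ### The canonical transversal -/

theorem isOpen_image2_seen {V : Set (E d)} {C : Set (Hull T)}
    (h : IsOpenEmbedding (fun q : V × C => seen (q.1 : E d) (q.2 : Hull T)))
    {O : Set (E d × Hull T)} (hO : IsOpen O) :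
    IsOpen {S | ∃ x ∈ V, ∃ c ∈ C, (x, c) ∈ O ∧ S = seen x c} := by
  have : {S | ∃ x ∈ V, ∃ c ∈ C, (x, c) ∈ O ∧ S = seen x c} =
      (fun q : V × C => seen (q.1 : E d) (q.2 : Hull T)) ''
        ((fun q : V × C => ((q.1 : E d), (q.2 : Hull T))) ⁻¹' O) := by
    ext S
    constructor
    · rintro ⟨x, hx, c, hc, hO, rfl⟩
      exact ⟨(⟨x, hx⟩, ⟨c, hc⟩), hO, rfl⟩
    · rintro ⟨⟨x, c⟩, hO, rfl⟩
      exact ⟨x, x.2, c, c.2, hO, rfl⟩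
  rw [this]
  exact h.isOpenMap _ (hO.preimage ((continuous_subtype_val.comp continuous_fst).prodMk
    (continuous_subtype_val.comp continuous_snd)))

theorem zero_mem_interior_of_puncture {y : X → E d} {r : ℝ}
    (hy : ∀ p : X, Metric.ball (y p) r ⊆ (p : Set (E d))) (p : X) {x : E d}
    (hx : x ∈ Metric.ball 0 r) : 0 ∈ interior (-x +ᵥ (-(y p) +ᵥ (p : Set (E d)))) := by
  rw [vadd_vadd, interior_vadd, mem_vadd_set_iff_neg_vadd_mem]
  refine interior_maximal (hy p) Metric.isOpen_ball ?_
  simpa [dist_eq_norm] using hx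

/-- A tile of a tiling is the translate of a prototile in a single way. -/
theorem vadd_prototile_inj (hX : ∀ p ∈ X, IsRect p)
    (hXtypes : ∀ p ∈ X, ∀ q ∈ X, ∀ u : E d, q = u +ᵥ p → p = q) {p q : X} {u v : E d}
    (h : u +ᵥ (p : Set (E d)) = v +ᵥ (q : Set (E d))) : p = q ∧ u = v := by
  have hpq : p = q := by
    refine Subtype.ext (hXtypes p p.2 q q.2 (-v + u) ?_)
    rw [← vadd_vadd, h, neg_vadd_vadd]
  subst hpq
  exact ⟨rfl, (hX p p.2).vadd_injective h⟩

/-- The chart map around the canonical transversal is injective: the tile with the origin in its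
interior determines its puncture. -/
theorem canonicalTransversal_unique (hX : ∀ p ∈ X, IsRect p)
    (hXtypes : ∀ p ∈ X, ∀ q ∈ X, ∀ u : E d, q = u +ᵥ p → p = q) {y : X → E d} {r : ℝ}
    (hy : ∀ p : X, Metric.ball (y p) r ⊆ (p : Set (E d))) {x x' : E d}
    (hx : x ∈ Metric.ball 0 r) (hx' : x' ∈ Metric.ball 0 r) {c c' : Hull T}
    (hc : c ∈ canonicalTransversal T y) (hc' : c' ∈ canonicalTransversal T y)
    (h : seen x c = seen x' c') : x = x' ∧ c = c' := by
  obtain ⟨p, hp⟩ := hc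
  obtain ⟨q, hq⟩ := hc'
  have h1 : -x +ᵥ (-(y p) +ᵥ (p : Set (E d))) ∈ (seen x c).tiles := by
    rwa [mem_tiles_seen, vadd_neg_vadd]
  have h2 : -x' +ᵥ (-(y q) +ᵥ (q : Set (E d))) ∈ (seen x c).tiles := by
    rwa [h, mem_tiles_seen, vadd_neg_vadd]
  have h3 := (seen x c).tile_eq hX h1 h2 (zero_mem_interior_of_puncture hy p hx)
    (interior_subset (zero_mem_interior_of_puncture hy q hx'))
  rw [vadd_vadd, vadd_vadd] at h3
  obtain ⟨rfl, h4⟩ := vadd_prototile_inj hX hXtypes h3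
  have hxx : x = x' := by simpa using h4
  subst hxx
  exact ⟨rfl, seen_injective x h⟩

namespace BoxSequence

variable (F : BoxSequence T)
include F

theorem prototileBox_mem {p : Set (E d)} (hp : p ∈ X) {S : Hull T} (hS : p ∈ S.tiles) :
    (⟨p, {S : Hull T | p ∈ S.tiles}⟩ : Box T) ∈ F.boxes 0 := by
  rw [F.zero]
  exact ⟨hp, rfl, S, hS⟩

theorem isCompact_prototile {p : Set (E d)} (hp : p ∈ X) :
    IsCompact {S : Hull T | p ∈ S.tiles} := by
  by_cases h : ∃ S : Hull T, p ∈ S.tiles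
  · obtain ⟨S, hS⟩ := h
    exact ((F.decomposition 0).isBox _ (F.prototileBox_mem hp hS)).compact
  · have : {S : Hull T | p ∈ S.tiles} = ∅ := by
      ext S
      exact ⟨fun hS => h ⟨S, hS⟩, fun hS => hS.elim⟩
    rw [this]
    exact isCompact_empty

theorem isCompact_canonicalTransversal (hXfin : X.Finite) (y : X → E d) :
    IsCompact (canonicalTransversal T y) := by
  have := hXfin.to_subtype
  have : canonicalTransversal T y = ⋃ p : X, seen (y p) '' {S : Hull T | p.1 ∈ S.tiles} := by
    ext S
    simp only [mem_iUnion]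
    constructor
    · rintro ⟨p, hp⟩
      refine ⟨p, seen (-(y p)) S, mem_tiles_seen.2 hp, ?_⟩
      rw [seen_seen, add_neg_cancel, seen_zero]
    · rintro ⟨p, R, hR, rfl⟩
      refine ⟨p, mem_tiles_seen.2 ?_⟩
      rwa [vadd_neg_vadd]
  rw [this]
  exact isCompact_iUnion fun p => (F.isCompact_prototile p.2).image (continuous_seen_right _)

/-- The canonical transversal is the transversal of a chart, as it consists of translates of the
transversals of the boxes given by the prototiles. -/
theorem isOpenEmbedding_canonicalTransversal (hX : ∀ p ∈ X, IsRect p)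
    (hXtypes : ∀ p ∈ X, ∀ q ∈ X, ∀ u : E d, q = u +ᵥ p → p = q) {y : X → E d} {r : ℝ}
    (hy : ∀ p : X, Metric.ball (y p) r ⊆ (p : Set (E d))) :
    IsOpenEmbedding (fun q : Metric.ball (0 : E d) r × canonicalTransversal T y =>
      seen (q.1 : E d) (q.2 : Hull T)) := by
  refine IsOpenEmbedding.of_continuous_injective_isOpenMap ?_ ?_ ?_
  · exact continuous_seen.comp ((continuous_subtype_val.comp continuous_fst).prodMk
      (continuous_subtype_val.comp continuous_snd))
  · rintro ⟨x, c⟩ ⟨x', c'⟩ h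
    obtain ⟨h1, h2⟩ := canonicalTransversal_unique hX hXtypes hy x.2 x'.2 c.2 c'.2 h
    exact Prod.ext (Subtype.ext h1) (Subtype.ext h2)
  · intro U hU
    have hind : IsInducing fun q : Metric.ball (0 : E d) r × canonicalTransversal T y =>
        ((q.1 : E d), (q.2 : Hull T)) :=
      IsInducing.subtypeVal.prodMap IsInducing.subtypeVal
    obtain ⟨O, hO, rfl⟩ := hind.isOpen_iff.1 hU
    -- near a tiling with a puncture of type `p` at the origin, the map is that of the box of `p`
    rw [isOpen_iff_mem_nhds]
    rintro _ ⟨⟨⟨x, hx⟩, ⟨c, p, hc⟩⟩, hxc, rfl⟩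
    have hcp : seen (-(y p)) c ∈ {S : Hull T | p.1 ∈ S.tiles} := mem_tiles_seen.2 hc
    have hbox := (F.decomposition 0).isBox _ (F.prototileBox_mem p.2 (S := seen (-(y p)) c) hcp)
    have hO' : IsOpen ((fun q : E d × Hull T => (q.1 - y p, seen (y p) q.2)) ⁻¹'
        (O ∩ Metric.ball 0 r ×ˢ univ)) := by
      refine (hO.inter (Metric.isOpen_ball.prod isOpen_univ)).preimage ?_
      exact (by fun_prop : Continuous fun q : E d × Hull T => q.1 - y p).prodMk
        ((continuous_seen_right _).comp continuous_snd)
    refine Filter.mem_of_superset ((isOpen_image2_seen hbox.emb hO').mem_nhds ?_) ?_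
    · refine ⟨x + y p, ?_, _, hcp, ?_, ?_⟩
      · refine interior_maximal (hy p) Metric.isOpen_ball ?_
        simpa [dist_eq_norm] using hx
      · simp only [mem_preimage, add_sub_cancel_right, seen_seen, add_neg_cancel, seen_zero]
        exact ⟨hxc, hx, trivial⟩
      · rw [seen_seen, add_neg_cancel_right]
    · rintro _ ⟨z, -, e, he, ⟨h1, h2, -⟩, rfl⟩
      refine ⟨(⟨z - y p, h2⟩, ⟨seen (y p) e, p, ?_⟩), h1, ?_⟩
      · rw [mem_tiles_seen, vadd_neg_vadd]
        exact he
      · simp only [seen_seen, sub_add_cancel]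

/-- The chart around the canonical transversal. -/
@[simps]
def canonicalChart (hX : ∀ p ∈ X, IsRect p)
    (hXtypes : ∀ p ∈ X, ∀ q ∈ X, ∀ u : E d, q = u +ᵥ p → p = q) (y : X → E d) {r : ℝ}
    (hr : 0 < r) (hy : ∀ p : X, Metric.ball (y p) r ⊆ (p : Set (E d))) : Chart T where
  V := Metric.ball 0 r
  C := canonicalTransversal T y
  isOpen := Metric.isOpen_ball
  bounded := Metric.isBounded_ball
  nonempty := Metric.nonempty_ball.2 hr
  emb := F.isOpenEmbedding_canonicalTransversal hX hXtypes hy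

end BoxSequence

/-! ### Regions -/

namespace Chart

/-- The measure of a product set in a chart. -/
theorem measure_image2_seen (K : Chart T) (μ : Measure (Hull T)) [IsFiniteMeasure μ]
    [VAddInvariantMeasure (E d) (Hull T) μ] {A : Set (E d)} (hAV : A ⊆ K.V)
    {B : Set (Hull T)} (hBC : B ⊆ K.C) :
    μ (image2 seen A B) = volume A * transverse μ K.V K.C (Subtype.val ⁻¹' B) := by
  have h : image2 seen A B = K.map '' ((Subtype.val ⁻¹' A) ×ˢ (Subtype.val ⁻¹' B)) := by
    ext S
    constructor
    · rintro ⟨x, hx, c, hc, rfl⟩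
      exact ⟨(⟨x, hAV hx⟩, ⟨c, hBC hc⟩), ⟨hx, hc⟩, rfl⟩
    · rintro ⟨⟨x, c⟩, ⟨hx, hc⟩, rfl⟩
      exact ⟨x, hx, c, hc, rfl⟩
  rw [h, ← K.measurableEmbedding_map.comap_apply, K.comap_map_eq_prod, Measure.prod_prod,
    comap_subtype_coe_apply K.isOpen.measurableSet, Subtype.image_preimage_coe,
    inter_eq_self_of_subset_right hAV]

end Chart

namespace BoxSequence

variable {F : BoxSequence T} {n : ℕ}

theorem Region.ext {R R' : F.Region n} (h : R.box = R'.box) (h' : R.tile = R'.tile) : R = R' := by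
  cases R; cases R'
  cases h; cases h'
  rfl

theorem Region.isBox (R : F.Region n) : R.box.IsBox :=
  (F.decomposition n).isBox _ R.box_mem

theorem Region.param_eq (R : F.Region n) {x : E d} (hx : x ∈ R.tile) {c : Hull T}
    (hc : c ∈ R.box.C) : R.param x = F.proj n (seen x c) :=
  Quot.sound ⟨R.box, R.box_mem, x, R.tile_subset hx, _, R.tile_mem.choose_spec.1, c, hc, rfl, rfl⟩

theorem Region.isRect (hX : ∀ p ∈ X, IsRect p) (R : F.Region n) : IsRect R.tile :=
  let ⟨c, _, h⟩ := R.tile_mem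
  c.isRect hX h

/-- The tilings in a vertical of a box have the same tiles in the block of this box. -/
theorem Region.tile_mem_tiles (hX : ∀ p ∈ X, IsRect p) (R : F.Region n) {c : Hull T}
    (hc : c ∈ R.box.C) : R.tile ∈ c.tiles := by
  obtain ⟨c₀, hc₀, h⟩ := R.tile_mem
  obtain ⟨z, hz⟩ := (R.isRect hX).interior_nonempty
  have hs : F.SameVertical n (seen z c₀) (seen z c) :=
    ⟨R.box, R.box_mem, z, R.tile_subset (interior_subset hz), c₀, hc₀, c, hc, rfl, rfl⟩
  have := hs.mem_tiles hX (t := -z +ᵥ R.tile) (by rwa [mem_tiles_seen, vadd_neg_vadd])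
    (by rw [interior_vadd]; exact ⟨z, hz, by simp⟩)
  rwa [mem_tiles_seen, vadd_neg_vadd] at this

/-- The interiors of the regions define disjoint subsets of the hull. -/
theorem Region.unique (hX : ∀ p ∈ X, IsRect p) {R R' : F.Region n} {x x' : E d}
    (hx : x ∈ interior R.tile) (hx' : x' ∈ interior R'.tile) {c c' : Hull T} (hc : c ∈ R.box.C)
    (hc' : c' ∈ R'.box.C) (h : seen x c = seen x' c') : R = R' ∧ x = x' ∧ c = c' := by
  obtain ⟨h1, rfl, rfl⟩ := box_unique R.box_mem R'.box_mem (interior_mono R.tile_subset hx)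
    (interior_mono R'.tile_subset hx') hc hc' h
  refine ⟨Region.ext h1 ?_, rfl, rfl⟩
  exact c.tile_eq hX (R.tile_mem_tiles hX hc) (R'.tile_mem_tiles hX hc') hx (interior_subset hx')

/-- Every tile of a tiling belongs to a region of `B_n`. -/
theorem exists_region (hX : ∀ p ∈ X, IsRect p) (n : ℕ) {S : Hull T} {t : Set (E d)}
    (ht : t ∈ S.tiles) : ∃ (R : F.Region n) (u : E d), seen u S ∈ R.box.C ∧ R.tile = -u +ᵥ t := by
  obtain ⟨β, hβ, u, hu, htu⟩ := exists_box_of_tile (F := F) hX n ht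
  exact ⟨⟨β, -u +ᵥ t, hβ, htu, seen u S, hu, by rwa [mem_tiles_seen, vadd_neg_vadd]⟩, u, hu, rfl⟩

/-- There are finitely many regions, as a block meets finitely many tiles of a tiling. -/
theorem finite_region (hXfin : X.Finite) (hX : ∀ p ∈ X, IsRect p) (n : ℕ) :
    Finite (F.Region n) := by
  have : Nonempty (Hull T) := ⟨T, subset_closure ⟨0, zero_vadd _ T⟩⟩
  have hne : ∀ β ∈ F.boxes n, ∃ c, c ∈ β.C := fun β hβ =>
    ((F.decomposition n).isBox β hβ).nonempty
  choose! c hc using hne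
  have hfin : (⋃ β ∈ F.boxes n,
      (fun t => (β, t)) '' {t ∈ (c β).tiles | (t ∩ β.P).Nonempty}).Finite :=
    (F.decomposition n).finite.biUnion fun β hβ => ((c β).1.finite_tiles_inter hXfin hX
      ((F.decomposition n).isBox β hβ).block.isCompact.isBounded).image _
  have := hfin.to_subtype
  refine Finite.of_injective (β := ↥(⋃ β ∈ F.boxes n,
      (fun t => (β, t)) '' {t ∈ (c β).tiles | (t ∩ β.P).Nonempty}))
    (fun R => ⟨(R.box, R.tile), ?_⟩) ?_
  · simp only [mem_iUnion]
    refine ⟨R.box, R.box_mem, R.tile, ⟨R.tile_mem_tiles hX (hc _ R.box_mem), ?_⟩, rfl⟩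
    rw [inter_eq_self_of_subset_left R.tile_subset]
    exact (R.isRect hX).nonempty
  · intro R R' h
    have h := Subtype.mk.inj h
    exact Region.ext (Prod.mk.inj h).1 (Prod.mk.inj h).2

/-- The chart given by the interior of a region. -/
@[simps]
def Region.chart (hX : ∀ p ∈ X, IsRect p) (R : F.Region n) : Chart T where
  V := interior R.tile
  C := R.box.C
  isOpen := isOpen_interior
  bounded := (R.isRect hX).isCompact.isBounded.subset interior_subset
  nonempty := (R.isRect hX).interior_nonempty
  emb := by
    have hsub : interior R.tile ⊆ interior R.box.P := interior_mono R.tile_subset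
    have h : IsOpenEmbedding (Prod.map (inclusion hsub) (id : R.box.C → R.box.C)) :=
      (IsOpenEmbedding.inclusion hsub (isOpen_interior.preimage continuous_subtype_val)).prodMap
        IsOpenEmbedding.id
    exact R.isBox.emb.comp h

variable (μ : Measure (Hull T))

/-- The transverse mass of a region, that is the coefficient of the region in the real cycle
defined by `μ`. -/
noncomputable def Region.mass (R : F.Region n) : ENNReal :=
  transverse μ (interior R.tile) R.box.C univ

variable [IsFiniteMeasure μ]

theorem Region.mass_ne_top (hX : ∀ p ∈ X, IsRect p) (R : F.Region n) : R.mass μ ≠ ⊤ :=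
  ((R.chart hX).isFiniteMeasure_transverse μ).measure_univ_lt_top.ne

variable [VAddInvariantMeasure (E d) (Hull T) μ]

theorem Region.measure_image2_seen (hX : ∀ p ∈ X, IsRect p) (R : F.Region n) {A : Set (E d)}
    (hAV : A ⊆ interior R.tile) :
    μ (image2 seen A R.box.C) = volume A * R.mass μ := by
  have h := (R.chart hX).measure_image2_seen μ hAV Subset.rfl
  rwa [Subtype.coe_preimage_self] at h

theorem Region.isOpen_image2_seen (hX : ∀ p ∈ X, IsRect p) (R : F.Region n) {A : Set (E d)}
    (hA : IsOpen A) (hAV : A ⊆ interior R.tile) : IsOpen (image2 seen A R.box.C) := by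
  have := TilingHull.isOpen_image2_seen (R.chart hX).emb (hA.prod isOpen_univ)
  convert this using 1
  ext S
  constructor
  · rintro ⟨x, hx, c, hc, rfl⟩
    exact ⟨x, hAV hx, c, hc, ⟨hx, trivial⟩, rfl⟩
  · rintro ⟨x, -, c, hc, ⟨hx, -⟩, rfl⟩
    exact ⟨x, hx, c, hc, rfl⟩

/-- Almost every tiling has the origin in the interior of a tile: along a leaf the exceptional
points form the countable union of the boundaries of the tiles. -/
theorem measure_compl_iUnion_domain (hX : ∀ p ∈ X, IsRect p) (n : ℕ) :
    μ (⋃ R : F.Region n, (R.chart hX).domain)ᶜ = 0 := by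
  set N := (⋃ R : F.Region n, (R.chart hX).domain)ᶜ with hN
  have hNm : MeasurableSet N :=
    (isOpen_iUnion fun R : F.Region n => (R.chart hX).isOpen_domain).measurableSet.compl
  have hleaf : ∀ S : Hull T, volume {x : E d | seen x S ∈ N} = 0 := by
    intro S
    have hc := S.1.countable
    refine measure_mono_null (t := ⋃ t ∈ S.tiles, frontier t) (fun x hx => ?_)
      ((measure_biUnion_null_iff hc).2 fun t ht => (S.isRect hX ht).volume_frontier)
    obtain ⟨t, ht, hxt⟩ := S.exists_tile x
    simp only [mem_iUnion]
    refine ⟨t, ht, ?_⟩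
    rw [(S.isRect hX ht).isClosed.frontier_eq]
    refine ⟨hxt, fun hxi => hx ?_⟩
    obtain ⟨R, u, hu, hR⟩ := exists_region (F := F) hX n ht
    refine mem_iUnion.2 ⟨R, x - u, ?_, seen u S, hu, by rw [seen_seen, sub_add_cancel]⟩
    rw [R.chart_V, hR, interior_vadd]
    exact ⟨x, hxi, by simp [sub_eq_neg_add]⟩
  have hmeas : Measurable fun q : E d × Hull T =>
      N.indicator (1 : Hull T → ENNReal) (seen q.1 q.2) :=
    (measurable_one.indicator hNm).comp continuous_seen.measurable
  have h1 : ∫⁻ S, (∫⁻ x in Metric.ball (0 : E d) 1, N.indicator 1 (seen x S)) ∂μ = 0 := by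
    have : ∀ S : Hull T, ∫⁻ x in Metric.ball (0 : E d) 1, N.indicator 1 (seen x S) = 0 := by
      intro S
      have hm : MeasurableSet {x : E d | seen x S ∈ N} :=
        (continuous_seen_left S).measurable hNm
      have : ∀ x : E d, N.indicator (1 : Hull T → ENNReal) (seen x S) =
        {x : E d | seen x S ∈ N}.indicator 1 x := fun x => rfl
      simp only [this]
      rw [lintegral_indicator_one hm]
      exact le_antisymm ((Measure.restrict_apply_le _ _).trans (hleaf S).le) bot_le
    simp only [this, lintegral_zero]
  rw [lintegral_lintegral_swap (f := fun (S : Hull T) (x : E d) => N.indicator 1 (seen x S))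
    (hmeas.comp measurable_swap).aemeasurable] at h1
  have h2 : ∀ x : E d, ∫⁻ S, N.indicator 1 (seen x S) ∂μ = μ N := by
    intro x
    rw [(measurePreserving_seen μ x).lintegral_comp (measurable_one.indicator hNm),
      lintegral_indicator_one hNm]
  simp only [h2, lintegral_const, Measure.restrict_apply_univ] at h1
  exact (mul_eq_zero.1 h1).resolve_right (Metric.measure_ball_pos _ _ one_pos).ne'

/-- The integral of a form over the hull is its integral over the real chain defined by `μ`. -/
theorem integral_coeff_eq_sum (hX : ∀ p ∈ X, IsRect p) [Fintype (F.Region n)] {ω : F.Field n d}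
    (hω : ω ∈ F.forms n d) :
    ∫ S, coeff (ω (F.proj n S)) ∂μ = ∑ R : F.Region n, (R.mass μ).toReal * R.integral ω := by
  have := F.compactSpace
  have hint : Integrable (fun S => coeff (ω (F.proj n S))) μ :=
    (continuous_coeff_forms hX hω).integrable_of_hasCompactSupport
      (HasCompactSupport.of_compactSpace _)
  have hae : (⋃ R : F.Region n, (R.chart hX).domain) =ᵐ[μ] univ :=
    Filter.eventuallyEq_univ.2 (measure_compl_iUnion_domain μ hX n)
  rw [← setIntegral_univ, ← setIntegral_congr_set hae, integral_iUnion_fintype]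
  · refine Finset.sum_congr rfl fun R _ => ?_
    rw [(R.chart hX).setIntegral_domain μ (g := fun S => coeff (ω (F.proj n S))) hint.integrableOn]
    have : ∀ c : (R.chart hX).C, (∫ x in (R.chart hX).V, coeff (ω (F.proj n (seen x c)))) =
        R.integral ω := by
      intro c
      rw [Region.integral, R.chart_V]
      rw [setIntegral_congr_set (interior_ae_eq_of_null_frontier (R.isRect hX).volume_frontier)]
      refine setIntegral_congr_fun (R.isRect hX).isClosed.measurableSet fun x hx => ?_
      simp only [R.param_eq hx c.2]
    simp only [this, integral_const, smul_eq_mul]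
    rfl
  · exact fun R => (R.chart hX).isOpen_domain.measurableSet
  · intro R R' hne
    refine disjoint_left.2 ?_
    rintro _ ⟨x, hx, c, hc, rfl⟩ ⟨x', hx', c', hc', h⟩
    exact hne (Region.unique hX hx hx' hc hc' h).1
  · exact fun R => hint.integrableOn

end BoxSequence

namespace BoxSequence

variable {F : BoxSequence T} {n : ℕ}

/-! ### The real cycle defined by an invariant measure -/

/-- The measure of the tilings at a point of a small set `A` from a fibre of `π_n`, computed by
means of a family `G` of germs of regions which contain the fibre and the translates of `A`. -/
theorem measure_image2_fiber (hX : ∀ p ∈ X, IsRect p) (μ : Measure (Hull T)) [IsFiniteMeasure μ]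
    [VAddInvariantMeasure (E d) (Hull T) μ] {b : F.Branched n} {A : Set (E d)} (hA : IsOpen A)
    (G : Finset (F.Region n × E d)) (hG : ∀ r ∈ G, r ∈ germs b)
    (h1 : ∀ r ∈ G, r.2 +ᵥ A ⊆ interior r.1.tile)
    (h2 : ∀ r ∈ G, ∀ r' ∈ G, ∀ z ∈ A, ∀ z' ∈ A, r.2 + z = r'.2 + z' → r.2 = r'.2)
    (h3 : ∀ S, F.proj n S = b → ∃ r ∈ G, ∃ c ∈ r.1.box.C, S = seen r.2 c) :
    μ (image2 seen A {S | F.proj n S = b}) = volume A * ∑ r ∈ G, r.1.mass μ := by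
  have hu : image2 seen A {S | F.proj n S = b} =
      ⋃ r ∈ G, image2 seen (r.2 +ᵥ A) r.1.box.C := by
    ext S
    simp only [mem_iUnion, exists_prop]
    constructor
    · rintro ⟨z, hz, R, hR, rfl⟩
      obtain ⟨r, hr, c, hc, rfl⟩ := h3 R hR
      exact ⟨r, hr, r.2 + z, ⟨z, hz, rfl⟩, c, hc, by rw [seen_seen, add_comm]⟩
    · rintro ⟨r, hr, _, ⟨z, hz, rfl⟩, c, hc, rfl⟩
      refine ⟨z, hz, seen r.2 c, ?_, by rw [seen_seen, add_comm]; rfl⟩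
      rw [mem_ofPred_eq, ← r.1.param_eq (hG r hr).1 hc]
      exact (hG r hr).2
  rw [hu, measure_biUnion_finset, Finset.mul_sum]
  · refine Finset.sum_congr rfl fun r hr => ?_
    rw [r.1.measure_image2_seen μ hX (h1 r hr), measure_vadd]
  · intro r hr r' hr' hne
    refine disjoint_left.2 ?_
    rintro _ ⟨x, hx, c, hc, rfl⟩ ⟨x', hx', c', hc', h⟩
    obtain ⟨e1, e2, -⟩ := Region.unique hX (h1 r hr hx) (h1 r' hr' hx') hc hc' h.symm
    obtain ⟨z, hz, rfl⟩ := hx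
    obtain ⟨z', hz', rfl⟩ := hx'
    exact hne (Prod.ext e1 (h2 r hr r' hr' z hz z' hz' e2))
  · exact fun r hr => (r.1.isOpen_image2_seen hX (hA.vadd r.2) (h1 r hr)).measurableSet

/-- In every direction `e` there is a tile that contains the origin and a point of the ray of `e`:
the tiles which do not contain the origin stay away from it. -/
theorem exists_tile_direction (hXfin : X.Finite) (hX : ∀ p ∈ X, IsRect p) (S : Hull T) (e : E d) :
    ∃ t ∈ S.tiles, 0 ∈ t ∧ ∃ δ : ℝ, 0 < δ ∧ δ • e ∈ t := by
  have hcl : IsClosed (⋃₀ {t ∈ S.tiles | 0 ∉ t}) :=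
    S.1.isClosed_sUnion_tiles hXfin hX fun t ht => ht.1
  have h0 : (⋃₀ {t ∈ S.tiles | 0 ∉ t})ᶜ ∈ 𝓝 ((0 : ℝ) • e) := by
    rw [zero_smul]
    exact hcl.isOpen_compl.mem_nhds fun ⟨t, ht, h⟩ => ht.2 h
  have hev : ∀ᶠ δ : ℝ in 𝓝[>] 0, δ • e ∈ (⋃₀ {t ∈ S.tiles | 0 ∉ t})ᶜ :=
    nhdsWithin_le_nhds ((by fun_prop : Continuous fun δ : ℝ => δ • e).tendsto 0 h0)
  obtain ⟨δ, hδ, hδ0⟩ := (hev.and self_mem_nhdsWithin).exists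
  obtain ⟨t, ht, hδt⟩ := S.exists_tile (δ • e)
  refine ⟨t, ht, ?_, δ, hδ0, hδt⟩
  by_contra hcon
  exact hδ ⟨t, ⟨ht, hcon⟩, hδt⟩

/-- A tiling `S` in the fibre of `b` provides a germ of region at `b` towards every direction. -/
theorem exists_germ_direction (hXfin : X.Finite) (hX : ∀ p ∈ X, IsRect p) (e : E d) {S : Hull T}
    {b : F.Branched n} (hS : F.proj n S = b) :
    ∃ r ∈ germs b, (∃ c ∈ r.1.box.C, S = seen r.2 c) ∧ ∃ δ : ℝ, 0 < δ ∧ r.2 + δ • e ∈ r.1.tile := by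
  obtain ⟨t, ht, h0, δ, hδ, hδt⟩ := exists_tile_direction hXfin hX S e
  obtain ⟨R, u, hu, hR⟩ := exists_region (F := F) hX n ht
  have hS' : S = seen (-u) (seen u S) := by rw [seen_seen, neg_add_cancel, seen_zero]
  have hmem : -u ∈ R.tile := by
    rw [hR]
    exact ⟨0, h0, by simp⟩
  refine ⟨(R, -u), ⟨hmem, ?_⟩, ⟨_, hu, hS'⟩, δ, hδ, ?_⟩
  · rw [R.param_eq hmem hu, ← hS', hS]
  · rw [hR]
    exact ⟨_, hδt, rfl⟩

theorem abs_apply_le_norm (z : E d) (i : Fin d) : |z i| ≤ ‖z‖ := PiLp.norm_apply_le z i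

/-- Small balls below a point of an upper face lie in the interior of the rectangle. -/
theorem IsUpper.eventually_vadd_subset {k : Fin d} {t : Set (E d)} {x : E d} (h : IsUpper k t x) :
    ∀ᶠ ε : ℝ in 𝓝[>] 0,
      x +ᵥ Metric.ball (-(ε • EuclideanSpace.single k (1 : ℝ))) (ε / 2) ⊆ interior t := by
  obtain ⟨a, b, hab, rfl, hk, hi⟩ := h
  have hev : ∀ᶠ ε : ℝ in 𝓝[>] 0, ∀ i, ε < (b i - a i) / 2 ∧
      (i ≠ k → ε < x i - a i ∧ ε < b i - x i) := by
    refine Filter.eventually_all.2 fun i => ?_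
    by_cases hik : i = k
    · filter_upwards [Ioo_mem_nhdsGT (half_pos (sub_pos.2 (hab i)))] with ε hε
      exact ⟨hε.2, fun h => absurd hik h⟩
    · filter_upwards [Ioo_mem_nhdsGT (half_pos (sub_pos.2 (hab i))),
        Ioo_mem_nhdsGT (sub_pos.2 (hi i hik).1), Ioo_mem_nhdsGT (sub_pos.2 (hi i hik).2)]
        with ε h1 h2 h3
      exact ⟨h1.2, fun _ => ⟨h2.2, h3.2⟩⟩
  filter_upwards [hev, self_mem_nhdsWithin] with ε hε hε0
  rintro _ ⟨z, hz, rfl⟩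
  rw [Metric.mem_ball, dist_eq_norm] at hz
  refine mem_interior_rect fun i => ?_
  have hz := abs_lt.1 ((abs_apply_le_norm _ i).trans_lt hz)
  have hε0 : 0 < ε := hε0
  have hε := hε i
  by_cases hik : i = k
  · subst hik
    simp only [sub_neg_eq_add, PiLp.add_apply, PiLp.smul_apply, PiLp.single_apply, if_true,
      smul_eq_mul, mul_one] at hz
    simp only [vadd_eq_add, PiLp.add_apply]
    constructor <;> linarith
  · simp only [sub_neg_eq_add, PiLp.add_apply, PiLp.smul_apply, PiLp.single_apply,
      hik, if_false, smul_eq_mul, mul_zero, add_zero] at hz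
    have := hε.2 hik
    simp only [vadd_eq_add, PiLp.add_apply]
    constructor <;> linarith

/-- Small balls above a point of a lower face lie in the interior of the rectangle. -/
theorem IsLower.eventually_vadd_subset {k : Fin d} {t : Set (E d)} {x : E d} (h : IsLower k t x) :
    ∀ᶠ ε : ℝ in 𝓝[>] 0,
      x +ᵥ Metric.ball (ε • EuclideanSpace.single k (1 : ℝ)) (ε / 2) ⊆ interior t := by
  obtain ⟨a, b, hab, rfl, hk, hi⟩ := h
  -- the reflection in the origin exchanges upper and lower faces
  have h' : IsUpper k (rect (-b) (-a)) (-x) := by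
    refine ⟨-b, -a, fun i => ?_, rfl, ?_, fun i hik => ?_⟩
    · simpa using hab i
    · simpa using hk
    · simpa using (hi i hik).symm
  have hneg : (fun x : E d => -x) ⁻¹' rect (-b) (-a) = rect a b := by
    ext z
    simp only [mem_preimage, rect, mem_ofPred_eq, PiLp.neg_apply, neg_le_neg_iff]
    exact forall_congr' fun i => and_comm
  filter_upwards [h'.eventually_vadd_subset] with ε hε
  rintro _ ⟨z, hz, rfl⟩
  have : -x + -z ∈ interior (rect (-b) (-a)) := by
    refine hε ⟨-z, ?_, rfl⟩
    rw [Metric.mem_ball, dist_neg_neg]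
    exact hz
  rw [← hneg]
  refine preimage_interior_subset_interior_preimage continuous_neg ?_
  change -(x + z) ∈ interior (rect (-b) (-a))
  rwa [neg_add]

/-- The transverse masses of the regions form a real cycle: the two sums are, up to a common
factor, the measures of the tilings at a point of a small ball below, respectively above, a point
of the fibre of `π_n`, and these sets differ by a translation. -/
theorem mass_isCycle (hXfin : X.Finite) (hX : ∀ p ∈ X, IsRect p) (μ : Measure (Hull T))
    [IsFiniteMeasure μ] [VAddInvariantMeasure (E d) (Hull T) μ] {k : Fin d} {b : F.Branched n}
    (hb : IsFacetPoint k b) :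
    ∑ᶠ r ∈ {r ∈ germs b | IsUpper k r.1.tile r.2}, (r.1.mass μ).toReal =
      ∑ᶠ r ∈ {r ∈ germs b | IsLower k r.1.tile r.2}, (r.1.mass μ).toReal := by
  set e : E d := EuclideanSpace.single k (1 : ℝ) with he
  have hU : {r ∈ germs b | IsUpper k r.1.tile r.2}.Finite := hb.1.subset (sep_subset _ _)
  have hL : {r ∈ germs b | IsLower k r.1.tile r.2}.Finite := hb.1.subset (sep_subset _ _)
  -- `ε` has to separate the germs since a region may have several germs at `b`
  have hsep : ∀ᶠ ε : ℝ in 𝓝[>] 0, ∀ r ∈ germs b, ∀ r' ∈ germs b, r.2 ≠ r'.2 →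
      ε < ‖r.2 - r'.2‖ := by
    refine (Filter.eventually_all_finite hb.1).2 fun r _ =>
      (Filter.eventually_all_finite hb.1).2 fun r' _ => ?_
    by_cases h : r.2 = r'.2
    · exact Filter.Eventually.of_forall fun _ h' => absurd h h'
    · filter_upwards [Ioo_mem_nhdsGT (norm_pos_iff.2 (sub_ne_zero.2 h))] with ε hε _
      exact hε.2
  obtain ⟨ε, ⟨⟨hεU, hεL⟩, hεs⟩, hε0⟩ :=
    ((((Filter.eventually_all_finite hU).2 fun r hr => hr.2.eventually_vadd_subset).and
      ((Filter.eventually_all_finite hL).2 fun r hr => hr.2.eventually_vadd_subset)).and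
        hsep |>.and self_mem_nhdsWithin).exists
  have hε0 : 0 < ε := hε0
  have hball : ∀ (w : E d) (r r' : F.Region n × E d), r ∈ germs b → r' ∈ germs b →
      ∀ z ∈ Metric.ball w (ε / 2), ∀ z' ∈ Metric.ball w (ε / 2), r.2 + z = r'.2 + z' →
      r.2 = r'.2 := by
    intro w r r' hr hr' z hz z' hz' h
    by_contra hne
    have h1 := hεs r hr r' hr' hne
    have h2 : r.2 - r'.2 = z' - z := by rw [sub_eq_sub_iff_add_eq_add, h, add_comm]
    rw [h2, ← dist_eq_norm] at h1
    linarith [dist_triangle_right z' z w, Metric.mem_ball.1 hz, Metric.mem_ball.1 hz']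
  -- a lower face does not continue downwards, so the tile found below the origin has an upper face
  have hmU := measure_image2_fiber hX μ (A := Metric.ball (-(ε • e)) (ε / 2)) (b := b)
    Metric.isOpen_ball hU.toFinset (fun r hr => (hU.mem_toFinset.1 hr).1)
    (fun r hr => hεU r (hU.mem_toFinset.1 hr))
    (fun r hr r' hr' => hball _ r r' (hU.mem_toFinset.1 hr).1 (hU.mem_toFinset.1 hr').1) (by
      intro S hS
      obtain ⟨r, hr, hc, δ, hδ, hδr⟩ := exists_germ_direction hXfin hX (-e) hS
      refine ⟨r, hU.mem_toFinset.2 ⟨hr, (hb.2 r hr).resolve_right ?_⟩, hc⟩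
      rintro ⟨a, a', -, ht, hk, -⟩
      rw [ht] at hδr
      have := (hδr k).1
      simp [he, hk] at this
      linarith)
  have hmL := measure_image2_fiber hX μ (A := Metric.ball (ε • e) (ε / 2)) (b := b)
    Metric.isOpen_ball hL.toFinset (fun r hr => (hL.mem_toFinset.1 hr).1)
    (fun r hr => hεL r (hL.mem_toFinset.1 hr))
    (fun r hr r' hr' => hball _ r r' (hL.mem_toFinset.1 hr).1 (hL.mem_toFinset.1 hr').1) (by
      intro S hS
      obtain ⟨r, hr, hc, δ, hδ, hδr⟩ := exists_germ_direction hXfin hX e hS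
      refine ⟨r, hL.mem_toFinset.2 ⟨hr, (hb.2 r hr).resolve_left ?_⟩, hc⟩
      rintro ⟨a, a', -, ht, hk, -⟩
      rw [ht] at hδr
      have := (hδr k).2
      simp [he, hk] at this
      linarith)
  have htrans : image2 seen (Metric.ball (ε • e) (ε / 2)) {S | F.proj n S = b} =
      seen ((2 * ε) • e) '' image2 seen (Metric.ball (-(ε • e)) (ε / 2)) {S | F.proj n S = b} := by
    ext S
    constructor
    · rintro ⟨z, hz, R, hR, rfl⟩
      refine ⟨_, ⟨z - (2 * ε) • e, ?_, R, hR, rfl⟩, by rw [seen_seen, add_sub_cancel]⟩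
      rw [Metric.mem_ball, dist_eq_norm] at hz ⊢
      convert hz using 2
      rw [two_mul, add_smul]
      abel
    · rintro ⟨_, ⟨z, hz, R, hR, rfl⟩, rfl⟩
      refine ⟨(2 * ε) • e + z, ?_, R, hR, by rw [seen_seen]⟩
      rw [Metric.mem_ball, dist_eq_norm] at hz ⊢
      convert hz using 2
      rw [two_mul, add_smul]
      abel
  rw [htrans, measure_image_seen, hmU, Measure.addHaar_ball_center volume (-(ε • e)),
    Measure.addHaar_ball_center volume (ε • e)] at hmL
  rw [finsum_mem_eq_finite_toFinset_sum _ hU, finsum_mem_eq_finite_toFinset_sum _ hL,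
    ← ENNReal.toReal_sum fun r _ => r.1.mass_ne_top μ hX,
    ← ENNReal.toReal_sum fun r _ => r.1.mass_ne_top μ hX]
  exact congrArg ENNReal.toReal ((ENNReal.mul_right_inj
    (Metric.measure_ball_pos _ _ (half_pos hε0)).ne' measure_ball_lt_top.ne).1 hmL)

end BoxSequence

/-! ### Values of the current on integral classes -/

/-- Finitely many real numbers `m i` generate a free abelian group: it has a basis `α`, in which
`m i` has the coordinates `q i`, and whose members are the integral combinations of the `m i` with
coefficients `s k`. -/
theorem exists_int_basis {R : Type*} [Fintype R] (m : R → ℝ) :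
    ∃ (κ : Type) (_ : Fintype κ) (α : κ → ℝ) (q : R → κ → ℤ) (s : κ → R → ℤ),
      LinearIndependent ℤ α ∧ (∀ i, m i = ∑ k, (q i k : ℝ) * α k) ∧
        ∀ k, α k = ∑ i, (s k i : ℝ) * m i := by
  set A := Submodule.span ℤ (range m)
  have hfin : Module.Finite ℤ A := Module.Finite.span_of_finite ℤ (finite_range m)
  set B := Module.Free.chooseBasis ℤ A
  have hs : ∀ k, ∃ c : R → ℤ, ∑ i, c i • m i = (B k : ℝ) := fun k =>
    (Submodule.mem_span_range_iff_exists_fun ℤ).1 (B k).2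
  choose s hs using hs
  refine ⟨_, inferInstance, fun k => (B k : ℝ),
    fun i k => B.repr ⟨m i, Submodule.subset_span ⟨i, rfl⟩⟩ k, s, ?_, fun i => ?_, fun k => ?_⟩
  · exact B.linearIndependent.map' A.subtype (Submodule.ker_subtype A)
  · have := congrArg (Subtype.val : A → ℝ) (B.sum_repr ⟨m i, Submodule.subset_span ⟨i, rfl⟩⟩)
    rw [Submodule.coe_sum] at this
    simpa using this.symm
  · simpa using (hs k).symm

namespace BoxSequence

variable {F : BoxSequence T} {n : ℕ}

/-- In a basis of the group generated by the transverse masses, the coordinates of the cycle of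
masses are integral cycles; hence the value of the current on an integral class belongs to this
group. -/
theorem exists_int_combination_mass (hXfin : X.Finite) (hX : ∀ p ∈ X, IsRect p)
    (μ : Measure (Hull T)) [IsFiniteMeasure μ] [VAddInvariantMeasure (E d) (Hull T) μ]
    [Fintype (F.Region n)] {ω : F.Field n d}
    (hω : ∀ c : F.Region n →₀ ℤ, IsCycle c → ∃ m : ℤ, chainIntegral c ω = m) :
    ∃ f : F.Region n → ℤ, ∑ R : F.Region n, (R.mass μ).toReal * R.integral ω =
      ∑ R, (f R : ℝ) * (R.mass μ).toReal := by
  obtain ⟨κ, _, α, q, s, hα, hq, hs⟩ := exists_int_basis fun R : F.Region n => (R.mass μ).toReal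
  have hcyc : ∀ k, IsCycle (Finsupp.equivFunOnFinite.symm fun R => q R k) := by
    intro k i b hb
    have hU : {r ∈ germs b | IsUpper i r.1.tile r.2}.Finite := hb.1.subset (sep_subset _ _)
    have hL : {r ∈ germs b | IsLower i r.1.tile r.2}.Finite := hb.1.subset (sep_subset _ _)
    have h := mass_isCycle hXfin hX μ hb
    rw [finsum_mem_eq_finite_toFinset_sum _ hU, finsum_mem_eq_finite_toFinset_sum _ hL] at h ⊢
    simp only [hq] at h
    rw [Finset.sum_comm, Finset.sum_comm (s := hL.toFinset), ← sub_eq_zero,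
      ← Finset.sum_sub_distrib] at h
    have h' : ∑ k, (∑ r ∈ hU.toFinset, q r.1 k - ∑ r ∈ hL.toFinset, q r.1 k) • α k = 0 := by
      rw [← h]
      refine Finset.sum_congr rfl fun k _ => ?_
      simp only [zsmul_eq_mul, Int.cast_sub, Int.cast_sum, sub_mul, Finset.sum_mul]
    exact sub_eq_zero.1 (Fintype.linearIndependent_iff.1 hα _ h' k)
  choose N hN using fun k => hω _ (hcyc k)
  have hN' : ∀ k, ∑ R, (q R k : ℝ) * R.integral ω = N k := by
    intro k
    rw [← hN k, chainIntegral, Finsupp.sum_fintype _ _ (by simp)]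
    rfl
  refine ⟨fun R => ∑ k, N k * s k R, ?_⟩
  calc ∑ R : F.Region n, (R.mass μ).toReal * R.integral ω
      = ∑ R, ∑ k, α k * ((q R k : ℝ) * R.integral ω) := by
        refine Finset.sum_congr rfl fun R _ => ?_
        rw [hq R, Finset.sum_mul]
        exact Finset.sum_congr rfl fun k _ => by ring
    _ = ∑ k, α k * N k := by
        rw [Finset.sum_comm]
        exact Finset.sum_congr rfl fun k _ => by rw [← Finset.mul_sum, hN' k]
    _ = ∑ k, ∑ R, (N k * s k R : ℝ) * (R.mass μ).toReal := by
        refine Finset.sum_congr rfl fun k _ => ?_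
        rw [hs k, mul_comm, Finset.mul_sum]
        exact Finset.sum_congr rfl fun R _ => by ring
    _ = _ := by
        rw [Finset.sum_comm]
        refine Finset.sum_congr rfl fun R _ => ?_
        rw [← Finset.sum_mul]
        push_cast
        rfl

/-- A region is a translate of a prototile `p`, and `a` is its puncture. -/
theorem Region.exists_puncture {y : X → E d} {r : ℝ}
    (hy : ∀ p : X, Metric.ball (y p) r ⊆ (p : Set (E d))) (R : F.Region n) :
    ∃ (p : X) (a : E d), R.tile = (a - y p) +ᵥ (p : Set (E d)) ∧
      Metric.ball a r ⊆ interior R.tile := by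
  obtain ⟨c, -, h⟩ := R.tile_mem
  obtain ⟨p, hp, u, hu⟩ := c.1.type_mem _ h
  refine ⟨⟨p, hp⟩, u + y ⟨p, hp⟩, by rw [add_sub_cancel_right, hu], ?_⟩
  refine interior_maximal (fun z hz => ?_) Metric.isOpen_ball
  rw [hu, mem_vadd_set_iff_sub_mem]
  refine hy ⟨p, hp⟩ ?_
  rw [Metric.mem_ball, dist_eq_norm] at hz ⊢
  rwa [sub_sub]

/-- The transverse mass of a region is the measure of the clopen set of the points of the
canonical transversal which lie in this region. -/
theorem Region.exists_indicator (hX : ∀ p ∈ X, IsRect p)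
    (hXtypes : ∀ p ∈ X, ∀ q ∈ X, ∀ u : E d, q = u +ᵥ p → p = q) {y : X → E d} {r : ℝ}
    (hr : 0 < r) (hy : ∀ p : X, Metric.ball (y p) r ⊆ (p : Set (E d))) (μ : Measure (Hull T))
    [IsFiniteMeasure μ] [VAddInvariantMeasure (E d) (Hull T) μ] (R : F.Region n) :
    ∃ g : C(canonicalTransversal T y, ℤ),
      ∫ S, (g S : ℝ) ∂(transverse μ (Metric.ball 0 r) (canonicalTransversal T y)) =
        (R.mass μ).toReal := by
  have := Hull.t2Space (T := T) hX
  obtain ⟨p, a, hpa, ha⟩ := R.exists_puncture hy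
  have haR : a ∈ interior R.tile := ha (Metric.mem_ball_self hr)
  set W : Set (canonicalTransversal T y) := Subtype.val ⁻¹' (seen a '' R.box.C) with hW
  have hsub : seen a '' R.box.C ⊆ canonicalTransversal T y := by
    rintro _ ⟨c, hc, rfl⟩
    refine ⟨p, mem_tiles_seen.2 ?_⟩
    rw [vadd_vadd, ← sub_eq_add_neg, ← hpa]
    exact R.tile_mem_tiles hX hc
  have hWc : IsClosed W :=
    (R.isBox.compact.image (continuous_seen_right a)).isClosed.preimage continuous_subtype_val
  have hWo : IsOpen W := by
    -- a point of the transversal in the interior of the region is its puncture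
    have : W = Subtype.val ⁻¹' (R.chart hX).domain := by
      ext ⟨S, q, hq⟩
      constructor
      · rintro ⟨c, hc, h⟩
        exact ⟨a, haR, c, hc, h.symm⟩
      · rintro ⟨x, hx, c, hc, h⟩
        change S = seen x c at h
        subst h
        have h1 : -x +ᵥ R.tile ∈ (seen x c).tiles := by
          rw [mem_tiles_seen, vadd_neg_vadd]
          exact R.tile_mem_tiles hX hc
        have h0 := zero_mem_interior_of_puncture hy q (Metric.mem_ball_self hr)
        rw [neg_zero, zero_vadd] at h0
        have h2 := (seen x c).tile_eq hX hq h1 h0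
          ⟨x, interior_subset hx, by simp⟩
        rw [hpa, vadd_vadd] at h2
        obtain ⟨rfl, h3⟩ := vadd_prototile_inj hX hXtypes h2
        have hxa : a = x := by
          rw [← sub_eq_zero, show a - x = -x + (a - y q) - -(y q) by abel, ← h3, sub_self]
        exact ⟨c, hc, by rw [hxa]⟩
    rw [this]
    exact (R.chart hX).isOpen_domain.preimage continuous_subtype_val
  refine ⟨⟨W.indicator 1, continuous_indicator
    (by simp [IsClopen.frontier_eq ⟨hWc, hWo⟩]) continuousOn_const⟩, ?_⟩
  have hmass : transverse μ (Metric.ball 0 r) (canonicalTransversal T y) W = R.mass μ := by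
    have h1 := (F.canonicalChart hX hXtypes y hr hy).measure_image2_seen μ
      (A := Metric.ball 0 r) Subset.rfl hsub
    have h2 := R.measure_image2_seen μ hX (A := a +ᵥ Metric.ball (0 : E d) r)
      (by
        rintro _ ⟨z, hz, rfl⟩
        exact ha (by simpa [dist_eq_norm] using hz))
    have h3 : image2 seen (a +ᵥ Metric.ball (0 : E d) r) R.box.C =
        image2 seen (Metric.ball (0 : E d) r) (seen a '' R.box.C) := by
      ext S
      constructor
      · rintro ⟨_, ⟨z, hz, rfl⟩, c, hc, rfl⟩
        exact ⟨z, hz, _, ⟨c, hc, rfl⟩, by rw [seen_seen, add_comm]; rfl⟩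
      · rintro ⟨z, hz, _, ⟨c, hc, rfl⟩, rfl⟩
        exact ⟨_, ⟨z, hz, rfl⟩, c, hc, by rw [seen_seen, add_comm]; rfl⟩
    rw [h3, h1, measure_vadd] at h2
    exact (ENNReal.mul_right_inj (Metric.measure_ball_pos _ _ hr).ne' measure_ball_lt_top.ne).1 h2
  have hcast : ∀ S, ((W.indicator 1 S : ℤ) : ℝ) = W.indicator 1 S := by
    intro S
    by_cases h : S ∈ W
    · simp [h]
    · simp [h]
  simp only [ContinuousMap.coe_mk, hcast]
  rw [integral_indicator_one hWc.measurableSet, measureReal_def, hmass]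

theorem isFiniteMeasure_transverse (F : BoxSequence T) (hX : ∀ p ∈ X, IsRect p)
    (hXtypes : ∀ p ∈ X, ∀ q ∈ X, ∀ u : E d, q = u +ᵥ p → p = q) {y : X → E d} {r : ℝ}
    (hr : 0 < r) (hy : ∀ p : X, Metric.ball (y p) r ⊆ (p : Set (E d))) (μ : Measure (Hull T))
    [IsFiniteMeasure μ] :
    IsFiniteMeasure (transverse μ (Metric.ball 0 r) (canonicalTransversal T y)) :=
  (F.canonicalChart hX hXtypes y hr hy).isFiniteMeasure_transverse μ

/-- The current of an integral class is the integral of an integer function on the canonical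
transversal, namely an integral combination of indicator functions of regions. -/
theorem exists_transversal_function_of_integral (hXfin : X.Finite) (hX : ∀ p ∈ X, IsRect p)
    (hXtypes : ∀ p ∈ X, ∀ q ∈ X, ∀ u : E d, q = u +ᵥ p → p = q) {y : X → E d} {r : ℝ}
    (hr : 0 < r) (hy : ∀ p : X, Metric.ball (y p) r ⊆ (p : Set (E d))) (μ : Measure (Hull T))
    [IsFiniteMeasure μ] [VAddInvariantMeasure (E d) (Hull T) μ] {ω : F.Field n d}
    (hω : ω ∈ F.forms n d)
    (hint : ∀ c : F.Region n →₀ ℤ, IsCycle c → ∃ m : ℤ, chainIntegral c ω = m) :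
    ∃ f : C(canonicalTransversal T y, ℤ),
      ∫ S, (f S : ℝ) ∂(transverse μ (Metric.ball 0 r) (canonicalTransversal T y)) =
        ∫ S, coeff (ω (F.proj n S)) ∂μ := by
  have := F.finite_region hXfin hX n
  have := Fintype.ofFinite (F.Region n)
  have := F.isFiniteMeasure_transverse hX hXtypes hr hy μ
  have := isCompact_iff_compactSpace.1 (F.isCompact_canonicalTransversal hXfin y)
  obtain ⟨f, hf⟩ := exists_int_combination_mass hXfin hX μ hint
  choose g hg using fun R : F.Region n => R.exists_indicator hX hXtypes hr hy μ
  refine ⟨∑ R, f R • g R, ?_⟩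
  rw [integral_coeff_eq_sum μ hX hω, hf]
  have hgi : ∀ R, Integrable (fun S => (f R : ℝ) * (g R S : ℝ))
      (transverse μ (Metric.ball 0 r) (canonicalTransversal T y)) := fun R =>
    Continuous.integrable_of_hasCompactSupport
      (continuous_const.mul (continuous_of_discreteTopology.comp (g R).continuous))
      (HasCompactSupport.of_compactSpace _)
  have : ∀ S, (((∑ R, f R • g R) S : ℤ) : ℝ) = ∑ R, (f R : ℝ) * (g R S : ℝ) := by
    intro S
    simp [ContinuousMap.coe_sum]
  simp only [this]
  rw [integral_finsetSum _ fun R _ => hgi R]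
  refine Finset.sum_congr rfl fun R _ => ?_
  rw [integral_const_mul, hg R]

end BoxSequence

/-! ### Realization of integer functions on the transversal -/

/-- The standard volume form on `E d`. -/
noncomputable def volumeForm (d : ℕ) : E d [⋀^Fin d]→L[ℝ] ℝ where
  __ := (Matrix.detRowAlternating (R := ℝ) (n := Fin d)).compLinearMap
    (EuclideanSpace.equiv (Fin d) ℝ).toLinearMap
  cont := by
    change Continuous fun v : Fin d → E d => Matrix.det fun i j => v i j
    exact Continuous.matrix_det (by fun_prop)

theorem coeff_smul_volumeForm (a : ℝ) : coeff (a • volumeForm d) = a := by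
  have : coeff (volumeForm d) = 1 := by
    change Matrix.det (fun i j => (EuclideanSpace.single i (1 : ℝ) : E d) j) = 1
    have h : (Matrix.of fun i j => (EuclideanSpace.single i (1 : ℝ) : E d) j) = 1 := by
      ext i j
      simp [Matrix.one_apply, eq_comm]
    exact (congrArg Matrix.det h).trans Matrix.det_one
  change a * coeff (volumeForm d) = a
  rw [this, mul_one]

/-- Alternating maps of degree `d + 1` on `E d` vanish. -/
theorem extDeriv_top_eq_zero (ω : E d → E d [⋀^Fin d]→L[ℝ] ℝ) (x : E d) : extDeriv ω x = 0 := by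
  ext v
  refine (extDeriv ω x).toAlternatingMap.map_linearDependent v fun h => ?_
  have := h.fintype_card_le_finrank
  simp at this

/-- The function on the hull which is `f c * χ x` at the point `c - x` of the chart around the
canonical transversal, and `0` outside of this chart. -/
noncomputable def spread {y : X → E d} (r : ℝ) (f : C(canonicalTransversal T y, ℤ))
    (χ : E d → ℝ) : Hull T → ℝ :=
  Function.extend (fun q : Metric.ball (0 : E d) r × canonicalTransversal T y =>
    seen (q.1 : E d) (q.2 : Hull T)) (fun q => f q.2 * χ q.1) 0

section spread

variable {y : X → E d} {r : ℝ} {f : C(canonicalTransversal T y, ℤ)} {χ : E d → ℝ}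

theorem spread_eq_zero {S : Hull T}
    (h : ∀ x ∈ Metric.ball (0 : E d) r, ∀ c ∈ canonicalTransversal T y, S ≠ seen x c) :
    spread r f χ S = 0 := by
  refine Function.extend_apply' _ _ _ ?_
  rintro ⟨⟨x, c⟩, rfl⟩
  exact h x x.2 c c.2 rfl

variable (hX : ∀ p ∈ X, IsRect p)
  (hXtypes : ∀ p ∈ X, ∀ q ∈ X, ∀ u : E d, q = u +ᵥ p → p = q)
  (hy : ∀ p : X, Metric.ball (y p) r ⊆ (p : Set (E d)))
include hX hXtypes hy

theorem spread_seen {x : E d} (hx : x ∈ Metric.ball 0 r) {c : Hull T}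
    (hc : c ∈ canonicalTransversal T y) : spread r f χ (seen x c) = f ⟨c, hc⟩ * χ x := by
  refine Function.Injective.extend_apply (f := fun q : Metric.ball (0 : E d) r ×
    canonicalTransversal T y => seen (q.1 : E d) (q.2 : Hull T)) ?_
    (fun q => f q.2 * χ q.1) 0 (⟨x, hx⟩, ⟨c, hc⟩)
  rintro ⟨x, c⟩ ⟨x', c'⟩ h
  obtain ⟨h1, h2⟩ := canonicalTransversal_unique hX hXtypes hy x.2 x'.2 c.2 c'.2 h
  exact Prod.ext (Subtype.ext h1) (Subtype.ext h2)

variable {F : BoxSequence T} {n : ℕ}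

/-- If `f` only depends on the verticals of the decomposition `n`, so does its extension. -/
theorem spread_sameVertical (hr : 0 < r)
    (hf : ∀ s s' : canonicalTransversal T y, F.SameVertical n s s' → f s = f s') {S S' : Hull T}
    (hS : F.SameVertical n S S') : spread r f χ S = spread r f χ S' := by
  have key : ∀ S S' : Hull T, F.SameVertical n S S' → ∀ x ∈ Metric.ball (0 : E d) r,
      ∀ c ∈ canonicalTransversal T y, S = seen x c → ∃ c' ∈ canonicalTransversal T y,
        S' = seen x c' ∧ F.SameVertical n c c' := by
    rintro S S' hS x hx c ⟨p, hp⟩ rfl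
    have ht : -x +ᵥ (-(y p) +ᵥ (p : Set (E d))) ∈ (seen x c).tiles := by
      rwa [mem_tiles_seen, vadd_neg_vadd]
    have h0 := zero_mem_interior_of_puncture hy p hx
    have hxt : -x ∈ -x +ᵥ (-(y p) +ᵥ (p : Set (E d))) :=
      ⟨0, ⟨y p, hy p (Metric.mem_ball_self hr), by simp⟩, by simp⟩
    have hv := hS.seen hX ht h0 hxt
    rw [seen_seen, neg_add_cancel, seen_zero] at hv
    refine ⟨seen (-x) S', ⟨p, ?_⟩, ?_, hv⟩
    · rw [mem_tiles_seen]
      exact hS.mem_tiles hX ht h0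
    · rw [seen_seen, add_neg_cancel, seen_zero]
  by_cases h : ∃ x ∈ Metric.ball (0 : E d) r, ∃ c ∈ canonicalTransversal T y, S = seen x c
  · obtain ⟨x, hx, c, hc, rfl⟩ := h
    obtain ⟨c', hc', rfl, hcc⟩ := key _ _ hS x hx c hc rfl
    rw [spread_seen hX hXtypes hy hx hc, spread_seen hX hXtypes hy hx hc',
      hf ⟨c, hc⟩ ⟨c', hc'⟩ hcc]
  · rw [spread_eq_zero fun x hx c hc e => h ⟨x, hx, c, hc, e⟩, spread_eq_zero]
    intro x hx c hc e
    obtain ⟨c', hc', e', -⟩ := key _ _ hS.symm x hx c hc e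
    exact h ⟨x, hx, c', hc', e'⟩

/-- The extension of `f` is smooth along the leaves: the closure of its support is contained in the
domain of the chart around the canonical transversal. -/
theorem contDiff_spread (F : BoxSequence T) (hXfin : X.Finite)
    (hχ : ContDiff ℝ ((⊤ : ℕ∞) : WithTop ℕ∞) χ) {s : ℝ}
    (hs : s < r) (hχs : Function.support χ ⊆ Metric.closedBall 0 s) (S : Hull T) :
    ContDiff ℝ ((⊤ : ℕ∞) : WithTop ℕ∞) fun x : E d => spread r f χ (seen x S) := by
  have := Hull.t2Space (T := T) hX
  rw [contDiff_iff_contDiffAt]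
  intro x₀
  by_cases h : ∃ x ∈ Metric.ball (0 : E d) r, ∃ c ∈ canonicalTransversal T y, seen x₀ S = seen x c
  · obtain ⟨x, hx, c, hc, e⟩ := h
    have hev : (fun z : E d => spread r f χ (seen z S)) =ᶠ[𝓝 x₀]
        fun z => f ⟨c, hc⟩ * χ (z - x₀ + x) := by
      have hz : ∀ᶠ z in 𝓝 x₀, z - x₀ + x ∈ Metric.ball (0 : E d) r := by
        refine (Continuous.tendsto' (by fun_prop) _ _ ?_).eventually (Metric.isOpen_ball.mem_nhds hx)
        simp
      filter_upwards [hz] with z hz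
      rw [← spread_seen hX hXtypes hy hz hc, ← seen_seen, ← e, seen_seen, sub_add_cancel]
    refine ContDiffAt.congr_of_eventuallyEq ?_ hev
    exact (contDiff_const.mul (hχ.comp (by fun_prop))).contDiffAt
  · set Z : Set (Hull T) := (fun q : E d × Hull T => seen q.1 q.2) ''
      (Metric.closedBall 0 s ×ˢ canonicalTransversal T y)
    have hZ : IsClosed Z := (((isCompact_closedBall _ _).prod
      (F.isCompact_canonicalTransversal hXfin y)).image continuous_seen).isClosed
    have hx₀ : seen x₀ S ∉ Z := by
      rintro ⟨⟨x, c⟩, ⟨hx, hc⟩, e⟩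
      exact h ⟨x, Metric.closedBall_subset_ball hs hx, c, hc, e.symm⟩
    have hev : (fun z : E d => spread r f χ (seen z S)) =ᶠ[𝓝 x₀] fun _ => 0 := by
      filter_upwards [(continuous_seen_left S).continuousAt.preimage_mem_nhds
        (hZ.isOpen_compl.mem_nhds hx₀)] with z hz
      by_cases h : ∃ x ∈ Metric.ball (0 : E d) r, ∃ c ∈ canonicalTransversal T y,
          seen z S = seen x c
      · obtain ⟨x, hx, c, hc, e⟩ := h
        rw [e, spread_seen hX hXtypes hy hx hc]
        have : χ x = 0 := by
          by_contra hne
          exact hz ⟨(x, c), ⟨hχs hne, hc⟩, e.symm⟩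
        rw [this, mul_zero]
      · exact spread_eq_zero fun x hx c hc e => h ⟨x, hx, c, hc, e⟩
    exact contDiffAt_const.congr_of_eventuallyEq hev

theorem integral_spread (F : BoxSequence T) (hr : 0 < r) (μ : Measure (Hull T)) [IsFiniteMeasure μ]
    [VAddInvariantMeasure (E d) (Hull T) μ] (hg : Integrable (spread r f χ) μ)
    (hχr : Function.support χ ⊆ Metric.ball 0 r) (hχ : ∫ x, χ x = 1) :
    ∫ S, spread r f χ S ∂μ =
      ∫ S, (f S : ℝ) ∂(transverse μ (Metric.ball 0 r) (canonicalTransversal T y)) := by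
  have h1 := (F.canonicalChart hX hXtypes y hr hy).setIntegral_domain μ hg.integrableOn
  rw [setIntegral_eq_integral_of_forall_compl_eq_zero] at h1
  · rw [h1]
    refine integral_congr_ae (Filter.Eventually.of_forall fun c => ?_)
    have hχ' : ∫ x in Metric.ball 0 r, χ x = 1 := by
      rw [setIntegral_eq_integral_of_forall_compl_eq_zero, hχ]
      intro x hx
      by_contra hne
      exact hx (hχr hne)
    change ∫ x in Metric.ball (0 : E d) r, spread r f χ (seen x c.1) = f c
    rw [setIntegral_congr_fun (g := fun x => f c * χ x) Metric.isOpen_ball.measurableSet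
      fun x hx => spread_seen hX hXtypes hy hx c.2, integral_const_mul, hχ', mul_one]
  · intro S hS
    exact spread_eq_zero fun x hx c hc e => hS ⟨x, hx, c, hc, e⟩

/-- A region contains one point of the canonical transversal, and the integral of `spread r f χ`
over this region is the value of `f` at this point. -/
theorem setIntegral_spread_region (R : F.Region n) {c : Hull T} (hc : c ∈ R.box.C)
    (hχr : Function.support χ ⊆ Metric.ball 0 r) (hχ : ∫ x, χ x = 1) :
    ∃ m : ℤ, ∫ x in R.tile, spread r f χ (seen x c) = m := by
  obtain ⟨p, a, hpa, ha⟩ := R.exists_puncture hy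
  have hac : seen a c ∈ canonicalTransversal T y := by
    refine ⟨p, mem_tiles_seen.2 ?_⟩
    rw [vadd_vadd, ← sub_eq_add_neg, ← hpa]
    exact R.tile_mem_tiles hX hc
  refine ⟨f ⟨_, hac⟩, ?_⟩
  have hval : ∀ x ∈ R.tile, spread r f χ (seen x c) = f ⟨_, hac⟩ * χ (x - a) := by
    intro x hx
    by_cases hxa : x - a ∈ Metric.ball (0 : E d) r
    · rw [← spread_seen hX hXtypes hy hxa hac, seen_seen, sub_add_cancel]
    · have : χ (x - a) = 0 := by
        by_contra hne
        exact hxa (hχr hne)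
      rw [this, mul_zero]
      refine spread_eq_zero ?_
      rintro x' hx' c' ⟨q, hq⟩ e
      refine hxa ?_
      have h1 : -x' +ᵥ (-(y q) +ᵥ (q : Set (E d))) ∈ (seen x c).tiles := by
        rwa [e, mem_tiles_seen, vadd_neg_vadd]
      have h2 : -x +ᵥ R.tile ∈ (seen x c).tiles := by
        rw [mem_tiles_seen, vadd_neg_vadd]
        exact R.tile_mem_tiles hX hc
      have h3 := (seen x c).tile_eq hX h1 h2 (zero_mem_interior_of_puncture hy q hx')
        ⟨x, hx, by simp⟩
      rw [hpa, vadd_vadd, vadd_vadd] at h3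
      obtain ⟨rfl, h4⟩ := vadd_prototile_inj hX hXtypes h3
      have : x - a = x' := by
        rw [← sub_eq_zero, show x - a - x' = (-x' + -y q) - (-x + (a - y q)) by abel, h4, sub_self]
      rwa [this]
  have hsupp : ∫ x in R.tile, χ (x - a) = 1 := by
    rw [setIntegral_eq_integral_of_forall_compl_eq_zero, integral_sub_right_eq_self, hχ]
    intro x hx
    by_contra hne
    refine hx (interior_subset (ha ?_))
    have := hχr hne
    simpa [dist_eq_norm] using this
  rw [setIntegral_congr_fun (R.isRect hX).isClosed.measurableSet hval, integral_const_mul, hsupp,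
    mul_one]

end spread

namespace BoxSequence

variable (F : BoxSequence T)

/-- A continuous integer function on the canonical transversal only depends on the verticals of
some decomposition: otherwise compactness provides two points on which it differs and which lie on
a common vertical of every decomposition. -/
theorem exists_level (hXfin : X.Finite) (hX : ∀ p ∈ X, IsRect p) {y : X → E d}
    (f : C(canonicalTransversal T y, ℤ)) :
    ∃ n, ∀ s s' : canonicalTransversal T y, F.SameVertical n s s' → f s = f s' := by
  have := Hull.t2Space (T := T) hX
  have := isCompact_iff_compactSpace.1 (F.isCompact_canonicalTransversal hXfin y)
  by_contra! hcon
  set D : ℕ → Set (canonicalTransversal T y × canonicalTransversal T y) := fun n =>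
    {q | F.SameVertical n q.1 q.2} ∩ {q | f q.1 ≠ f q.2}
  have hcl : ∀ n, IsClosed (D n) := by
    intro n
    refine IsClosed.inter ?_ ?_
    · exact (isClosed_sameVertical hX n).preimage
        ((continuous_subtype_val.comp continuous_fst).prodMk
          (continuous_subtype_val.comp continuous_snd))
    · have : Continuous fun q : canonicalTransversal T y × canonicalTransversal T y =>
          (f q.1, f q.2) := by fun_prop
      exact (isClosed_discrete {z : ℤ × ℤ | z.1 ≠ z.2}).preimage this
  obtain ⟨⟨s, s'⟩, hs⟩ := IsCompact.nonempty_iInter_of_sequence_nonempty_isCompact_isClosed D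
    (fun n q hq => ⟨F.proj_succ n hq.1, hq.2⟩)
    (fun n => let ⟨s, s', h, h'⟩ := hcon n; ⟨(s, s'), h, h'⟩)
    (hcl 0).isCompact hcl
  rw [mem_iInter] at hs
  have : s = s' := Subtype.ext (eq_of_forall_sameVertical (F := F) hXfin hX fun n => (hs n).1)
  exact (hs 0).2 (congrArg f this)

/-- Every integer function on the canonical transversal has the same integral as a form with
integer values on all integral chains. -/
theorem exists_integral_form (hXfin : X.Finite) (hX : ∀ p ∈ X, IsRect p)
    (hXtypes : ∀ p ∈ X, ∀ q ∈ X, ∀ u : E d, q = u +ᵥ p → p = q) {y : X → E d} {r : ℝ}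
    (hr : 0 < r) (hy : ∀ p : X, Metric.ball (y p) r ⊆ (p : Set (E d))) (μ : Measure (Hull T))
    [IsFiniteMeasure μ] [VAddInvariantMeasure (E d) (Hull T) μ]
    (f : C(canonicalTransversal T y, ℤ)) :
    ∃ (n : ℕ) (ω : F.closedForms n d),
      (∀ c : F.Region n →₀ ℤ, ∃ m : ℤ, chainIntegral c ω.1 = m) ∧
      ∫ S, coeff (ω.1 (F.proj n S)) ∂μ =
        ∫ S, (f S : ℝ) ∂(transverse μ (Metric.ball 0 r) (canonicalTransversal T y)) := by
  have := F.compactSpace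
  obtain ⟨n, hn⟩ := F.exists_level hXfin hX f
  let B : ContDiffBump (0 : E d) := ⟨r / 4, r / 2, by positivity, by linarith⟩
  set χ : E d → ℝ := B.normed volume
  have hχs : Function.support χ ⊆ Metric.closedBall 0 (r / 2) := by
    rw [B.support_normed_eq]
    exact Metric.ball_subset_closedBall
  have hχr : Function.support χ ⊆ Metric.ball 0 r :=
    hχs.trans (Metric.closedBall_subset_ball (by linarith))
  have hχ1 : ∫ x, χ x = 1 := B.integral_normed
  let ω : F.Field n d := Quot.lift (fun S => spread r f χ S • volumeForm d) fun S S' h => by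
    rw [spread_sameVertical hX hXtypes hy hr hn h]
  have hcoeff : ∀ S, coeff (ω (F.proj n S)) = spread r f χ S := fun S =>
    coeff_smul_volumeForm _
  have hω : ω ∈ F.forms n d := fun S =>
    (contDiff_spread hX hXtypes hy F hXfin B.contDiff_normed (by linarith) hχs S).smul
      contDiff_const
  refine ⟨n, ⟨ω, hω, fun S x => extDeriv_top_eq_zero _ _⟩, fun c => ?_, ?_⟩
  -- the integral over each region is an integer, so that no cycle condition is needed
  · have hR : ∀ R : F.Region n, ∃ m : ℤ, R.integral ω = m := by
      intro R
      obtain ⟨m, hm⟩ := setIntegral_spread_region (f := f) hX hXtypes hy R R.tile_mem.choose_spec.1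
        hχr hχ1
      refine ⟨m, ?_⟩
      rw [← hm]
      exact integral_congr_ae (Filter.Eventually.of_forall fun x => hcoeff _)
    choose m hm using hR
    refine ⟨c.sum fun R k => k * m R, ?_⟩
    rw [chainIntegral, Finsupp.sum, Finsupp.sum]
    push_cast
    exact Finset.sum_congr rfl fun R _ => by rw [hm R]
  · simp only [hcoeff]
    refine integral_spread hX hXtypes hy F hr μ ?_ hχr hχ1
    refine ((continuous_coeff_forms hX hω).congr hcoeff).integrable_of_hasCompactSupport
      (HasCompactSupport.of_compactSpace _)

/-! ### The linear form defined by the current -/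

/-- Integration of closed `d`-forms on `B_n` over the hull. -/
noncomputable def currentForms (hX : ∀ p ∈ X, IsRect p) (μ : Measure (Hull T)) [IsFiniteMeasure μ]
    (n : ℕ) : F.closedForms n d →ₗ[ℝ] ℝ where
  toFun ω := ∫ S, coeff (ω.1 (F.proj n S)) ∂μ
  map_add' ω η := by
    have := F.compactSpace
    exact integral_add
      ((continuous_coeff_forms hX ω.2.1).integrable_of_hasCompactSupport
        (HasCompactSupport.of_compactSpace _))
      ((continuous_coeff_forms hX η.2.1).integrable_of_hasCompactSupport
        (HasCompactSupport.of_compactSpace _))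
  map_smul' a ω := integral_const_mul a _

/-- The linear form on the cohomology of the inverse limit defined by the current; it exists since
the current kills exact forms. -/
noncomputable def currentLimit (hX : ∀ p ∈ X, IsRect p) (μ : Measure (Hull T)) [IsFiniteMeasure μ]
    [VAddInvariantMeasure (E d) (Hull T) μ] : F.DeRhamLimit d →ₗ[ℝ] ℝ :=
  Module.DirectLimit.lift ℝ ℕ (fun n => F.DeRham n d) (F.pullDeRham d)
    (fun n => Submodule.liftQ _ (F.currentForms hX μ n) fun _ hω => integral_exactForms hX μ hω)
    (by
      intro i j h x
      obtain ⟨ω, rfl⟩ := Submodule.Quotient.mk_surjective _ x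
      rfl)

theorem currentLimit_formClass (hX : ∀ p ∈ X, IsRect p) (μ : Measure (Hull T)) [IsFiniteMeasure μ]
    [VAddInvariantMeasure (E d) (Hull T) μ] (n : ℕ) (ω : F.closedForms n d) :
    F.currentLimit hX μ (F.toLimit n d (F.formClass n d ω)) =
      ∫ S, coeff (ω.1 (F.proj n S)) ∂μ := by
  rw [currentLimit, toLimit, Module.DirectLimit.lift_of]
  rfl

end BoxSequence

end TilingHull

theorem mainTheorem4 {d : ℕ} (hd : 0 < d)
    -- finitely many prototiles, pairwise of distinct types, that are well oriented rectangles
    {X : Set (Set (E d))} (hXfin : X.Finite) (hXrect : ∀ p ∈ X, IsRect p)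
    (hXtypes : ∀ p ∈ X, ∀ q ∈ X, ∀ u : E d, q = u +ᵥ p → p = q)
    -- a perfect tiling and the box decompositions that define its expanding flattening sequence
    (T : Tiling X) (hT : T.IsPerfect) (F : BoxSequence T)
    -- the punctures, with a radius on which they define a chart around the canonical transversal
    (y : X → E d) (r : ℝ) (hr : 0 < r) (hy : ∀ p : X, Metric.ball (y p) r ⊆ (p : Set (E d)))
    -- a finite invariant measure on the hull
    (μ : Measure (Hull T)) [IsFiniteMeasure μ] [VAddInvariantMeasure (E d) (Hull T) μ]
    -- a finite atlas with a subordinate partition of unity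
    {ι : Type*} [Fintype ι] (K : ι → Chart T) (ρ : PartitionOfUnity ι (Hull T))
    (hρ : ρ.IsSubordinate fun i => (K i).domain) :
    ∃ Φ : F.DeRhamLimit d →ₗ[ℝ] ℝ,
      (∀ (n : ℕ) (ω : F.closedForms n d),
        Φ (F.toLimit n d (F.formClass n d ω)) =
          ruelleSullivan K ρ μ (fun S => ω.1 (F.proj n S))) ∧
      Φ '' F.integralLimit =
        range fun f : C(canonicalTransversal T y, ℤ) =>
          ∫ S, (f S : ℝ) ∂(transverse μ (Metric.ball 0 r) (canonicalTransversal T y)) := by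
  have := F.compactSpace
  refine ⟨F.currentLimit hXrect μ, fun n ω => ?_, Subset.antisymm ?_ ?_⟩
  · rw [F.currentLimit_formClass, ruelleSullivan_eq_integral K ρ hρ μ
      (BoxSequence.continuous_coeff_forms hXrect ω.2.1)]
  · rintro _ ⟨x, hx, rfl⟩
    obtain ⟨n, _, ⟨ω, hω, rfl⟩, rfl⟩ := mem_iUnion.1 hx
    rw [F.currentLimit_formClass]
    exact BoxSequence.exists_transversal_function_of_integral hXfin hXrect hXtypes hr hy μ ω.2.1 hω
  · rintro _ ⟨f, rfl⟩
    obtain ⟨n, ω, hω, h⟩ := F.exists_integral_form hXfin hXrect hXtypes hr hy μ f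
    refine ⟨_, mem_iUnion.2 ⟨n, _, ⟨ω, fun c _ => hω c, rfl⟩, rfl⟩, ?_⟩
    rw [F.currentLimit_formClass, h]
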